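/- Let $S$ be a (discrete) Clifford semigroup, that is, an inverse semigroup (each $s\in S$ has a unique $s^*\in S$ with $ss^*s=s$ and $s^*ss^*=s^*$) such that $ss^*=s^*s$ for every $s\in S$. Let $E(S)$ be its set of idempotents, ordered by $f\le e \iff f=fe=ef$, and assume that $E(S)$ is uniformly locally finite: $\sup_{e\in E(S)}|\{f\in E(S): f\le e\}|<\infty$. For $e\in E(S)$ let $G_e=\{s\in S: ss^*=s^*s=e\}$ be the maximal subgroup at $e$, so that $S=\bigcup_{e\in E(S)}G_e$. Let $\ell^1(S)$ be the complex semigroup Banach algebra with the convolution product, and equip the bidual $\ell^1(S)^{**}$ with the first Arens product. For a complex Banach algebra $A$ let $A\otimes_p A$ be the (completed) projective tensor product with the actions $a\cdot(b\otimes c)=ab\otimes c$, $(b\otimes c)\cdot a=b\otimes ca$, and let $\pi_A:A\otimes_pA\to A$ be the product map $\pi_A(a\otimes b)=ab$. The algebra $A$ is approximately biprojective if there is a net $(\rho_\alpha)$ of continuous $A$-bimodule morphisms $A\to A\otimes_pA$ with $\pi_A(\rho_\alpha(a))\to a$ for every $a\in A$; it is pseudo-amenable if there is a (not necessarily bounded)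 net $(m_\alpha)$ in $A\otimes_pA$ with $a\cdot m_\alpha-m_\alpha\cdot a\to0$ and $\pi_A(m_\alpha)a\to a$ for every $a\in A$. A semigroup $T$ is amenable if there are elements $m,m'\in\ell^1(T)^{**}$ with $\delta_t\cdot m=m$ and $m'\cdot\delta_t=m'$ for all $t\in T$, and $\|m\|=m(\varphi)=1=\|m'\|=m'(\varphi)$, where $\varphi(f)=\sum_{t\in T} f(t)$ is the augmentation character of $\ell^1(T)$. Theorem. If $\ell^1(S)^{**}$ is approximately biprojective, then every maximal subgroup $G_e$, $e\in E(S)$, is amenable, and $\ell^1(S)$ is pseudo-amenable. -/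

import Mathlib

open Filter Topology TensorProduct

universe u

noncomputable section

/-! ### Inverse semigroups, Clifford semigroups, maximal subgroups -/

/-- `t` is an inverse of `s` in the sense of semigroup theory: `s t s = s` and `t s t = t`. -/
def IsSemigroupInverse {S : Type u} [Semigroup S] (s t : S) : Prop :=
  s * t * s = s ∧ t * s * t = t

/-- An inverse semigroup: every `s` has exactly one inverse `s*`. -/
def IsInverseSemigroup (S : Type u) [Semigroup S] : Prop :=
  ∀ s : S, ∃! t : S, IsSemigroupInverse s t

/-- A Clifford semigroup: an inverse semigroup with `s s* = s* s` for every `s`. -/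
def IsCliffordSemigroup (S : Type u) [Semigroup S] : Prop :=
  IsInverseSemigroup S ∧ ∀ s t : S, IsSemigroupInverse s t → s * t = t * s

/-- The set `(e] = {f ∈ E(S) : f ≤ e}` in the partially ordered set `E(S)` of idempotents, where
`f ≤ e` means `f = f e = e f`. -/
def idempotentsBelow {S : Type u} [Semigroup S] (e : S) : Set S :=
  {f | IsIdempotentElem f ∧ f = f * e ∧ f = e * f}

/-- `E(S)` is uniformly locally finite: the sets `(e]`, `e ∈ E(S)`, are finite, with a common bound
for their cardinalities. -/
def IdempotentsUniformlyLocallyFinite (S : Type u) [Semigroup S] : Prop :=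
  ∃ C : ℕ, ∀ e : S, IsIdempotentElem e →
    (idempotentsBelow e).Finite ∧ (idempotentsBelow e).ncard ≤ C

/-- The maximal subgroup `G_e = {s : s s* = s* s = e}` (with the multiplication of `S`). -/
def maximalSubgroup {S : Type u} [Semigroup S] (e : S) : Subsemigroup S where
  carrier := {s | ∃ t, IsSemigroupInverse s t ∧ s * t = e ∧ t * s = e}
  mul_mem' := by
    rintro a b ⟨a', ⟨ha1, ha2⟩, ha3, ha4⟩ ⟨b', ⟨hb1, hb2⟩, hb3, hb4⟩
    have h1 : a * b * (b' * a') = e := by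
      rw [mul_assoc, ← mul_assoc b, hb3, ← ha4, ha2, ha3, ha4]
    have h2 : b' * a' * (a * b) = e := by
      rw [mul_assoc, ← mul_assoc a', ha4, ← hb3, hb1, hb4, hb3]
    refine ⟨b' * a', ⟨?_, ?_⟩, h1, h2⟩
    · rw [h1, ← ha3, ← mul_assoc, ha1]
    · rw [h2, ← hb4, ← mul_assoc, hb2]

/-! ### The Banach algebra `ℓ¹(S)` -/

/-- The Banach space `ℓ¹(S)`. -/
abbrev L1 (S : Type u) : Type u := lp (fun _ : S => ℂ) 1

namespace L1

theorem summable_norm {S : Type u} (f : L1 S) : Summable fun s => ‖f s‖ := by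
  simpa using (lp.memℓp f).summable (by simp)

theorem norm_eq {S : Type u} (f : L1 S) : ‖f‖ = ∑' s, ‖f s‖ := by
  simpa using lp.norm_eq_tsum_rpow (by simp) f

theorem summable_prod {S : Type u} (f g : L1 S) : Summable fun p : S × S => ‖f p.1 * g p.2‖ :=
  (Summable.mul_norm (f := f) (g := g) (summable_norm f) (summable_norm g))

variable {S : Type u} [Semigroup S]

/-- The convolution product, `(f * g)(s) = ∑_{t u = s} f(t) g(u)`. -/
def convFun (f g : L1 S) (s : S) : ℂ :=
  ∑' p : {p : S × S // p.1 * p.2 = s}, f p.1.1 * g p.1.2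

theorem summable_fiber (f g : L1 S) (s : S) :
    Summable fun p : {p : S × S // p.1 * p.2 = s} => ‖f p.1.1 * g p.1.2‖ :=
  (summable_prod f g).subtype _

theorem summable_sigma (f g : L1 S) :
    Summable fun q : Σ s : S, {p : S × S // p.1 * p.2 = s} => ‖f q.2.1.1 * g q.2.1.2‖ :=
  (Equiv.sigmaFiberEquiv (fun p : S × S => p.1 * p.2)).summable_iff.2 (summable_prod f g)

theorem norm_convFun_le (f g : L1 S) (s : S) :
    ‖convFun f g s‖ ≤ ∑' p : {p : S × S // p.1 * p.2 = s}, ‖f p.1.1 * g p.1.2‖ :=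
  norm_tsum_le_tsum_norm (summable_fiber f g s)

theorem summable_norm_convFun (f g : L1 S) : Summable fun s => ‖convFun f g s‖ :=
  Summable.of_nonneg_of_le (fun _ => norm_nonneg _) (norm_convFun_le f g) (summable_sigma f g).sigma

/-- The convolution product as an element of `ℓ¹(S)`. -/
def conv (f g : L1 S) : L1 S :=
  ⟨convFun f g, memℓp_gen (by simpa using summable_norm_convFun f g)⟩

theorem conv_apply (f g : L1 S) (s : S) :
    conv f g s = ∑' p : {p : S × S // p.1 * p.2 = s}, f p.1.1 * g p.1.2 := rfl

theorem norm_conv_le (f g : L1 S) : ‖conv f g‖ ≤ ‖f‖ * ‖g‖ := by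
  rw [norm_eq, norm_eq f, norm_eq g,
    tsum_mul_tsum_of_summable_norm (by simpa using summable_norm f)
      (by simpa using summable_norm g)]
  have h := (Equiv.sigmaFiberEquiv (fun p : S × S => p.1 * p.2)).tsum_eq
    (fun p : S × S => ‖f p.1 * g p.2‖)
  simp only [← norm_mul]
  rw [← h]
  refine ((summable_norm_convFun f g).tsum_le_tsum (norm_convFun_le f g)
    (summable_sigma f g).sigma).trans_eq ?_
  exact (Summable.tsum_sigma (summable_sigma f g)).symm

theorem conv_add (f g h : L1 S) : conv f (g + h) = conv f g + conv f h := by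
  ext s
  simp only [lp.coeFn_add, Pi.add_apply, conv_apply, mul_add]
  exact Summable.tsum_add (summable_fiber f g s).of_norm (summable_fiber f h s).of_norm

theorem add_conv (f g h : L1 S) : conv (f + g) h = conv f h + conv g h := by
  ext s
  simp only [lp.coeFn_add, Pi.add_apply, conv_apply, add_mul]
  exact Summable.tsum_add (summable_fiber f h s).of_norm (summable_fiber g h s).of_norm

theorem smul_conv (c : ℂ) (f g : L1 S) : conv (c • f) g = c • conv f g := by
  ext s
  simp only [lp.coeFn_smul, Pi.smul_apply, conv_apply, smul_eq_mul, mul_assoc, tsum_mul_left]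

theorem conv_smul (c : ℂ) (f g : L1 S) : conv f (c • g) = c • conv f g := by
  ext s
  simp only [lp.coeFn_smul, Pi.smul_apply, conv_apply, smul_eq_mul, mul_left_comm _ c,
    tsum_mul_left]

theorem zero_conv (f : L1 S) : conv 0 f = 0 := by simpa using smul_conv 0 0 f

theorem conv_zero (f : L1 S) : conv f 0 = 0 := by simpa using conv_smul 0 f 0

/-- Convolution as a continuous bilinear map. -/
def convL : L1 S →L[ℂ] L1 S →L[ℂ] L1 S :=
  LinearMap.mkContinuous₂ (LinearMap.mk₂ ℂ conv add_conv smul_conv conv_add conv_smul) 1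
    (fun f g => by simpa using norm_conv_le f g)

theorem convL_apply (f g : L1 S) : convL f g = conv f g := rfl

open Classical in
/-- The point mass `δ_s`. -/
def delta {S : Type u} (s : S) : L1 S := lp.single 1 s 1

open Classical in
theorem conv_delta (t u : S) : conv (delta t) (delta u) = delta (t * u) := by
  ext s
  rw [conv_apply]
  simp only [delta, lp.single_apply]
  by_cases h : t * u = s
  · rw [tsum_eq_single ⟨(t, u), h⟩]
    · simp [← h]
    · rintro ⟨⟨a, b⟩, hab⟩ hne
      have : ¬ (a = t ∧ b = u) := by
        rintro ⟨rfl, rfl⟩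
        exact hne rfl
      by_cases ha : a = t
      · have hb : b ≠ u := fun hb => this ⟨ha, hb⟩
        simp [Pi.single_apply, hb]
      · simp [Pi.single_apply, ha]
  · have hs : s ≠ t * u := fun h' => h h'.symm
    rw [Pi.single_eq_of_ne hs]
    convert tsum_zero with p
    obtain ⟨⟨a, b⟩, hab⟩ := p
    by_cases ha : a = t
    · have hb : b ≠ u := by
        rintro rfl
        exact h (ha ▸ hab)
      simp [Pi.single_apply, hb]
    · simp [Pi.single_apply, ha]

theorem ext_delta {S : Type u} {E : Type*} [NormedAddCommGroup E] [NormedSpace ℂ E]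
    {F G : L1 S →L[ℂ] E} (h : ∀ s, F (delta s) = G (delta s)) : F = G := by
  classical
  refine lp.ext_continuousLinearMap (by simp) fun s => ?_
  ext
  simpa [delta] using h s

theorem conv_assoc (f g h : L1 S) : conv (conv f g) h = conv f (conv g h) := by
  have h1 : ∀ (t u : S) (f : L1 S), conv (conv f (delta t)) (delta u) =
      conv f (conv (delta t) (delta u)) := by
    intro t u f
    have : (convL.flip (delta u)).comp (convL.flip (delta t)) =
        convL.flip (conv (delta t) (delta u)) :=
      ext_delta fun s => by
        simp only [ContinuousLinearMap.comp_apply, ContinuousLinearMap.flip_apply, convL_apply,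
          conv_delta, mul_assoc]
    exact DFunLike.congr_fun this f
  have h2 : ∀ (u : S) (f g : L1 S), conv (conv f g) (delta u) = conv f (conv g (delta u)) := by
    intro u f g
    have : (convL.flip (delta u)).comp (convL f) = (convL f).comp (convL.flip (delta u)) :=
      ext_delta fun s => h1 s u f
    exact DFunLike.congr_fun this g
  have h3 : convL (conv f g) = (convL f).comp (convL g) := ext_delta fun s => h2 s f g
  exact DFunLike.congr_fun h3 h

instance instNonUnitalNormedRing : NonUnitalNormedRing (lp (fun _ : S => ℂ) 1) :=
  { (inferInstance : NormedAddCommGroup (lp (fun _ : S => ℂ) 1)) with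
    mul := conv
    left_distrib := conv_add
    right_distrib := add_conv
    zero_mul := zero_conv
    mul_zero := conv_zero
    mul_assoc := conv_assoc
    norm_mul_le := norm_conv_le }

theorem mul_apply (f g : L1 S) (s : S) :
    (f * g) s = ∑' p : {p : S × S // p.1 * p.2 = s}, f p.1.1 * g p.1.2 := rfl

instance instIsScalarTower : IsScalarTower ℂ (lp (fun _ : S => ℂ) 1) (lp (fun _ : S => ℂ) 1) :=
  ⟨fun c f g => smul_conv c f g⟩

instance instSMulCommClass : SMulCommClass ℂ (lp (fun _ : S => ℂ) 1) (lp (fun _ : S => ℂ) 1) :=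
  ⟨fun c f g => (conv_smul c f g).symm⟩

/-- The augmentation character `f ↦ ∑_s f(s)`. -/
def augmentation (S : Type u) : StrongDual ℂ (L1 S) :=
  LinearMap.mkContinuous
    { toFun := fun f => ∑' s, f s
      map_add' := fun f g => (summable_norm f).of_norm.tsum_add (summable_norm g).of_norm
      map_smul' := fun c f => by simp [tsum_mul_left] } 1
    (fun f => by
      rw [one_mul, norm_eq]
      exact norm_tsum_le_tsum_norm (summable_norm f))

end L1

/-! ### The bidual of a Banach algebra with the (first) Arens product -/

/-- The bidual `A**`. -/
def Bidual (A : Type u) [NormedAddCommGroup A] [NormedSpace ℂ A] : Type u :=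
  StrongDual ℂ (StrongDual ℂ A)

namespace Bidual

section Space

variable (A : Type u) [NormedAddCommGroup A] [NormedSpace ℂ A]

instance instNormedAddCommGroup : NormedAddCommGroup (Bidual A) :=
  inferInstanceAs (NormedAddCommGroup (StrongDual ℂ (StrongDual ℂ A)))

instance instFunLike : FunLike (Bidual A) (StrongDual ℂ A) ℂ :=
  inferInstanceAs (FunLike (StrongDual ℂ (StrongDual ℂ A)) (StrongDual ℂ A) ℂ)

instance instNormedSpace : NormedSpace ℂ (Bidual A) :=
  inferInstanceAs (NormedSpace ℂ (StrongDual ℂ (StrongDual ℂ A)))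

instance instCompleteSpace : CompleteSpace (Bidual A) :=
  inferInstanceAs (CompleteSpace (StrongDual ℂ (StrongDual ℂ A)))

/-- The canonical embedding `A → A**`, `a ↦ (φ ↦ φ a)`. -/
def incl : A →L[ℂ] Bidual A := NormedSpace.inclusionInDoubleDual ℂ A

variable {A}

theorem map_add' (F : Bidual A) (φ ψ : StrongDual ℂ A) : F (φ + ψ) = F φ + F ψ :=
  ContinuousLinearMap.map_add (F : StrongDual ℂ (StrongDual ℂ A)) φ ψ

theorem map_smul' (F : Bidual A) (c : ℂ) (φ : StrongDual ℂ A) : F (c • φ) = c * F φ :=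
  ContinuousLinearMap.map_smul (F : StrongDual ℂ (StrongDual ℂ A)) c φ

theorem le_norm (F : Bidual A) (φ : StrongDual ℂ A) : ‖F φ‖ ≤ ‖F‖ * ‖φ‖ :=
  ContinuousLinearMap.le_opNorm (F : StrongDual ℂ (StrongDual ℂ A)) φ

theorem ext {F G : Bidual A} (h : ∀ φ, F φ = G φ) : F = G :=
  ContinuousLinearMap.ext h

end Space

variable {A : Type u} [NonUnitalNormedRing A] [NormedSpace ℂ A] [IsScalarTower ℂ A A]
  [SMulCommClass ℂ A A]

/-- The functional `φ · a ∈ A*`, `(φ · a)(b) = φ (a b)`. -/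
def dualSMul (φ : StrongDual ℂ A) (a : A) : StrongDual ℂ A :=
  φ.comp (ContinuousLinearMap.mul ℂ A a)

theorem dualSMul_apply (φ : StrongDual ℂ A) (a b : A) : dualSMul φ a b = φ (a * b) := rfl

theorem norm_dualSMul_le (φ : StrongDual ℂ A) (a : A) : ‖dualSMul φ a‖ ≤ ‖φ‖ * ‖a‖ :=
  (ContinuousLinearMap.opNorm_comp_le _ _).trans <|
    mul_le_mul_of_nonneg_left (ContinuousLinearMap.opNorm_mul_apply_le ℂ A a) (norm_nonneg _)

/-- The functional `G · φ ∈ A*`, `(G · φ)(a) = G (φ · a)`. -/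
def bidualSMul (G : Bidual A) (φ : StrongDual ℂ A) : StrongDual ℂ A :=
  LinearMap.mkContinuous
    { toFun := fun a => G (dualSMul φ a)
      map_add' := fun a b => by
        rw [← map_add']
        exact congrArg G (by ext x; simp [dualSMul_apply, add_mul])
      map_smul' := fun c a => by
        rw [RingHom.id_apply, smul_eq_mul, ← map_smul']
        exact congrArg G (by ext x; simp [dualSMul_apply, smul_mul_assoc]) } (‖G‖ * ‖φ‖)
    (fun a => by
      rw [mul_assoc]
      exact (le_norm G _).trans (mul_le_mul_of_nonneg_left (norm_dualSMul_le φ a) (norm_nonneg _)))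

theorem bidualSMul_apply (G : Bidual A) (φ : StrongDual ℂ A) (a : A) :
    bidualSMul G φ a = G (dualSMul φ a) := rfl

theorem norm_bidualSMul_le (G : Bidual A) (φ : StrongDual ℂ A) :
    ‖bidualSMul G φ‖ ≤ ‖G‖ * ‖φ‖ :=
  LinearMap.mkContinuous_norm_le _ (by positivity) _

/-- The first Arens product `F □ G`, `(F □ G)(φ) = F (G · φ)`. -/
def arens (F G : Bidual A) : Bidual A :=
  LinearMap.mkContinuous
    { toFun := fun φ => F (bidualSMul G φ)
      map_add' := fun φ ψ => by
        rw [← map_add']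
        refine congrArg F (ContinuousLinearMap.ext fun a => ?_)
        simp only [add_apply, bidualSMul_apply]
        rw [← map_add']
        rfl
      map_smul' := fun c φ => by
        rw [RingHom.id_apply, smul_eq_mul, ← map_smul']
        refine congrArg F (ContinuousLinearMap.ext fun a => ?_)
        simp only [smul_apply, bidualSMul_apply, smul_eq_mul]
        rw [← map_smul']
        rfl } (‖F‖ * ‖G‖)
    (fun φ => by
      rw [mul_assoc]
      exact (le_norm F _).trans
        (mul_le_mul_of_nonneg_left (norm_bidualSMul_le G φ) (norm_nonneg _)))

theorem arens_apply (F G : Bidual A) (φ : StrongDual ℂ A) :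
    arens F G φ = F (bidualSMul G φ) := rfl

theorem norm_arens_le (F G : Bidual A) : ‖arens F G‖ ≤ ‖F‖ * ‖G‖ :=
  LinearMap.mkContinuous_norm_le _ (by positivity) _

theorem arens_assoc (F G H : Bidual A) : arens (arens F G) H = arens F (arens G H) := by
  refine ext fun φ => ?_
  rw [arens_apply, arens_apply, arens_apply]
  refine congrArg F (ContinuousLinearMap.ext fun a => ?_)
  rw [bidualSMul_apply, bidualSMul_apply, arens_apply]
  refine congrArg G (ContinuousLinearMap.ext fun b => ?_)
  rw [bidualSMul_apply, dualSMul_apply, bidualSMul_apply]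
  refine congrArg H (ContinuousLinearMap.ext fun c => ?_)
  simp only [dualSMul_apply, mul_assoc]

theorem bidualSMul_add (F G : Bidual A) (φ : StrongDual ℂ A) :
    bidualSMul (F + G) φ = bidualSMul F φ + bidualSMul G φ := rfl

theorem bidualSMul_smul (c : ℂ) (F : Bidual A) (φ : StrongDual ℂ A) :
    bidualSMul (c • F) φ = c • bidualSMul F φ := rfl

theorem bidualSMul_zero (φ : StrongDual ℂ A) : bidualSMul (0 : Bidual A) φ = 0 := rfl

/-- The Banach algebra `(A**, □)`. -/
instance instNonUnitalNormedRing : NonUnitalNormedRing (Bidual A) :=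
  { instNormedAddCommGroup A with
    mul := arens
    left_distrib := fun F G H => ext fun φ => by
      show F (bidualSMul (G + H) φ) = F (bidualSMul G φ) + F (bidualSMul H φ)
      rw [bidualSMul_add, map_add']
    right_distrib := fun F G H => rfl
    zero_mul := fun F => rfl
    mul_zero := fun F => ext fun φ =>
      ContinuousLinearMap.map_zero (F : StrongDual ℂ (StrongDual ℂ A))
    mul_assoc := arens_assoc
    norm_mul_le := norm_arens_le }

theorem mul_apply (F G : Bidual A) (φ : StrongDual ℂ A) : (F * G) φ = F (bidualSMul G φ) := rfl

instance instIsScalarTower : IsScalarTower ℂ (Bidual A) (Bidual A) :=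
  ⟨fun _ _ _ => rfl⟩

instance instSMulCommClass : SMulCommClass ℂ (Bidual A) (Bidual A) :=
  ⟨fun c F G => ext fun φ => by
    show c • F (bidualSMul G φ) = F (bidualSMul (c • G) φ)
    rw [bidualSMul_smul, map_smul', smul_eq_mul]⟩

end Bidual

/-! ### The projective tensor product -/

section Projective

variable (E F : Type u) [NormedAddCommGroup E] [NormedSpace ℂ E] [NormedAddCommGroup F]
  [NormedSpace ℂ F]

/-- The algebraic tensor product `E ⊗ F`, to be equipped with the projective norm. -/
def AlgTensor : Type u := E ⊗[ℂ] F

namespace AlgTensor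

instance instAddCommGroup : AddCommGroup (AlgTensor E F) :=
  inferInstanceAs (AddCommGroup (E ⊗[ℂ] F))

instance instModule : Module ℂ (AlgTensor E F) :=
  inferInstanceAs (Module ℂ (E ⊗[ℂ] F))

variable {E F}

/-- The elementary tensor `a ⊗ b`. -/
def tmul (a : E) (b : F) : AlgTensor E F := a ⊗ₜ[ℂ] b

/-- The sums `∑ ‖a i‖ ‖b i‖` over all finite representations `x = ∑ a i ⊗ b i`. -/
def reprSums (x : AlgTensor E F) : Set ℝ :=
  {r | ∃ (n : ℕ) (a : Fin n → E) (b : Fin n → F),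
    x = ∑ i, tmul (a i) (b i) ∧ r = ∑ i, ‖a i‖ * ‖b i‖}

/-- The projective norm, `inf {∑ ‖a i‖ ‖b i‖ : x = ∑ a i ⊗ b i}`. -/
def projNorm (x : AlgTensor E F) : ℝ := sInf (reprSums x)

theorem reprSums_nonneg {x : AlgTensor E F} {r : ℝ} (hr : r ∈ reprSums x) : 0 ≤ r := by
  obtain ⟨n, a, b, -, rfl⟩ := hr
  positivity

theorem reprSums_bddBelow (x : AlgTensor E F) : BddBelow (reprSums x) :=
  ⟨0, fun _ hr => reprSums_nonneg hr⟩

theorem tmul_mem (a : E) (b : F) : ‖a‖ * ‖b‖ ∈ reprSums (tmul a b) :=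
  ⟨1, fun _ => a, fun _ => b, by simp, by simp⟩

theorem zero_mem : (0 : ℝ) ∈ reprSums (0 : AlgTensor E F) :=
  ⟨0, Fin.elim0, Fin.elim0, by simp, by simp⟩

theorem add_mem {x y : AlgTensor E F} {r s : ℝ} (hr : r ∈ reprSums x) (hs : s ∈ reprSums y) :
    r + s ∈ reprSums (x + y) := by
  obtain ⟨n, a, b, rfl, rfl⟩ := hr
  obtain ⟨m, c, d, rfl, rfl⟩ := hs
  exact ⟨n + m, Fin.append a c, Fin.append b d, by simp [Fin.sum_univ_add],
    by simp [Fin.sum_univ_add]⟩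

theorem smul_mem (c : ℂ) {x : AlgTensor E F} {r : ℝ} (hr : r ∈ reprSums x) :
    ‖c‖ * r ∈ reprSums (c • x) := by
  obtain ⟨n, a, b, rfl, rfl⟩ := hr
  refine ⟨n, fun i => c • a i, b, ?_, ?_⟩
  · rw [Finset.smul_sum]
    rfl
  · simp [Finset.mul_sum, norm_smul, mul_assoc]

theorem reprSums_nonempty (x : AlgTensor E F) : (reprSums x).Nonempty := by
  induction x using TensorProduct.induction_on with
  | zero => exact ⟨0, zero_mem⟩
  | tmul a b => exact ⟨_, tmul_mem a b⟩
  | add x y hx hy => exact ⟨_, add_mem hx.some_mem hy.some_mem⟩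

theorem projNorm_zero : projNorm (0 : AlgTensor E F) = 0 :=
  le_antisymm (csInf_le (reprSums_bddBelow _) zero_mem)
    (Real.sInf_nonneg fun _ hr => reprSums_nonneg hr)

theorem projNorm_add_le (x y : AlgTensor E F) : projNorm (x + y) ≤ projNorm x + projNorm y := by
  refine le_of_forall_pos_le_add fun ε hε => ?_
  obtain ⟨r, hr, hr'⟩ := exists_lt_of_csInf_lt (reprSums_nonempty x)
    (show projNorm x < projNorm x + ε / 2 by linarith)
  obtain ⟨s, hs, hs'⟩ := exists_lt_of_csInf_lt (reprSums_nonempty y)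
    (show projNorm y < projNorm y + ε / 2 by linarith)
  have := csInf_le (reprSums_bddBelow _) (add_mem hr hs)
  unfold projNorm at *
  linarith

theorem projNorm_smul_le (c : ℂ) (x : AlgTensor E F) : projNorm (c • x) ≤ ‖c‖ * projNorm x := by
  rcases eq_or_ne c 0 with rfl | hc
  · simp [projNorm_zero]
  have hc' : 0 < ‖c‖ := norm_pos_iff.2 hc
  rw [← div_le_iff₀' hc']
  refine le_csInf (reprSums_nonempty x) fun r hr => ?_
  rw [div_le_iff₀' hc']
  exact csInf_le (reprSums_bddBelow _) (smul_mem c hr)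

/-- The projective norm as a seminorm on the algebraic tensor product. -/
def projSeminorm : Seminorm ℂ (AlgTensor E F) :=
  Seminorm.ofSMulLE projNorm projNorm_zero projNorm_add_le projNorm_smul_le

instance instSeminormedAddCommGroup : SeminormedAddCommGroup (AlgTensor E F) :=
  AddGroupSeminorm.toSeminormedAddCommGroup projSeminorm.toAddGroupSeminorm

theorem norm_def (x : AlgTensor E F) : ‖x‖ = projNorm x := rfl

instance instNormedSpace : NormedSpace ℂ (AlgTensor E F) := ⟨projNorm_smul_le⟩

theorem norm_tmul_le (a : E) (b : F) : ‖tmul a b‖ ≤ ‖a‖ * ‖b‖ :=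
  csInf_le (reprSums_bddBelow _) (tmul_mem a b)

/-- The linear map on `E ⊗ F` induced by a bounded bilinear map. -/
def liftLin {G : Type*} [NormedAddCommGroup G] [NormedSpace ℂ G] (B : E →L[ℂ] F →L[ℂ] G) :
    AlgTensor E F →ₗ[ℂ] G :=
  (TensorProduct.lift ((ContinuousLinearMap.coeLM ℂ).comp (B : E →ₗ[ℂ] F →L[ℂ] G)) :
      E ⊗[ℂ] F →ₗ[ℂ] G)

theorem liftLin_tmul {G : Type*} [NormedAddCommGroup G] [NormedSpace ℂ G]
    (B : E →L[ℂ] F →L[ℂ] G) (a : E) (b : F) : liftLin B (tmul a b) = B a b := rfl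

theorem norm_liftLin_le {G : Type*} [NormedAddCommGroup G] [NormedSpace ℂ G]
    (B : E →L[ℂ] F →L[ℂ] G) (x : AlgTensor E F) : ‖liftLin B x‖ ≤ ‖B‖ * ‖x‖ := by
  have key : ∀ r ∈ reprSums x, ‖liftLin B x‖ ≤ ‖B‖ * r := by
    rintro r ⟨n, a, b, rfl, rfl⟩
    rw [map_sum, Finset.mul_sum]
    refine (norm_sum_le _ _).trans (Finset.sum_le_sum fun i _ => ?_)
    rw [← mul_assoc]
    exact B.le_opNorm₂ (a i) (b i)
  rcases (norm_nonneg B).eq_or_lt with h0 | hB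
  · obtain ⟨r, hr⟩ := reprSums_nonempty x
    simpa [← h0] using key r hr
  · rw [norm_def, ← div_le_iff₀' hB]
    exact le_csInf (reprSums_nonempty x) fun r hr => (div_le_iff₀' hB).2 (key r hr)

/-- The bounded linear map on `E ⊗ F` induced by a bounded bilinear map. -/
def lift {G : Type*} [NormedAddCommGroup G] [NormedSpace ℂ G] (B : E →L[ℂ] F →L[ℂ] G) :
    AlgTensor E F →L[ℂ] G :=
  LinearMap.mkContinuous (liftLin B) ‖B‖ (norm_liftLin_le B)

theorem lift_tmul {G : Type*} [NormedAddCommGroup G] [NormedSpace ℂ G] (B : E →L[ℂ] F →L[ℂ] G)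
    (a : E) (b : F) : lift B (tmul a b) = B a b := rfl

theorem add_tmul (a a' : E) (b : F) : tmul (a + a') b = tmul a b + tmul a' b :=
  TensorProduct.add_tmul a a' b

theorem tmul_add (a : E) (b b' : F) : tmul a (b + b') = tmul a b + tmul a b' :=
  TensorProduct.tmul_add a b b'

theorem smul_tmul (c : ℂ) (a : E) (b : F) : tmul (c • a) b = c • tmul a b :=
  TensorProduct.smul_tmul' c a b

theorem tmul_smul (c : ℂ) (a : E) (b : F) : tmul a (c • b) = c • tmul a b :=
  TensorProduct.tmul_smul c a b

end AlgTensor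

/-- The projective tensor product `E ⊗_p F`: the completion of `E ⊗ F` for the projective norm. -/
abbrev ProjTensor : Type u := UniformSpace.Completion (AlgTensor E F)

variable {E F}

namespace ProjTensor

/-- The canonical bounded bilinear map `(a, b) ↦ a ⊗ b` into `E ⊗_p F`. -/
def tmulL : E →L[ℂ] F →L[ℂ] ProjTensor E F :=
  LinearMap.mkContinuous₂
    (LinearMap.mk₂ ℂ (fun a b => ((AlgTensor.tmul a b : AlgTensor E F) : ProjTensor E F))
      (fun a a' b => by rw [AlgTensor.add_tmul, UniformSpace.Completion.coe_add])
      (fun c a b => by rw [AlgTensor.smul_tmul, UniformSpace.Completion.coe_smul])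
      (fun a b b' => by rw [AlgTensor.tmul_add, UniformSpace.Completion.coe_add])
      (fun c a b => by rw [AlgTensor.tmul_smul, UniformSpace.Completion.coe_smul])) 1
    (fun a b => by
      rw [one_mul, LinearMap.mk₂_apply, UniformSpace.Completion.norm_coe]
      exact AlgTensor.norm_tmul_le a b)

theorem tmulL_apply (a : E) (b : F) :
    tmulL a b = ((AlgTensor.tmul a b : AlgTensor E F) : ProjTensor E F) := rfl

/-- The bounded linear map on `E ⊗_p F` induced by a bounded bilinear map into a Banach space. -/
def lift {G : Type*} [NormedAddCommGroup G] [NormedSpace ℂ G] [CompleteSpace G]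
    (B : E →L[ℂ] F →L[ℂ] G) : ProjTensor E F →L[ℂ] G :=
  (AlgTensor.lift B).extend UniformSpace.Completion.toComplL

theorem lift_tmul {G : Type*} [NormedAddCommGroup G] [NormedSpace ℂ G] [CompleteSpace G]
    (B : E →L[ℂ] F →L[ℂ] G) (a : E) (b : F) : lift B (tmulL a b) = B a b :=
  ContinuousLinearMap.extend_eq (AlgTensor.lift B) (UniformSpace.Completion.denseRange_coe)
    (UniformSpace.Completion.isUniformInducing_coe _) (AlgTensor.tmul a b)

end ProjTensor

end Projective

section BanachAlgebra

variable {A : Type u} [NonUnitalNormedRing A] [NormedSpace ℂ A] [IsScalarTower ℂ A A]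
  [SMulCommClass ℂ A A]

namespace ProjTensor

/-- The left action on `A ⊗_p A`, `a · (b ⊗ c) = ab ⊗ c`. -/
def actL (a : A) : ProjTensor A A →L[ℂ] ProjTensor A A :=
  lift (tmulL.comp (ContinuousLinearMap.mul ℂ A a))

theorem actL_tmul (a b c : A) : actL a (tmulL b c) = tmulL (a * b) c := lift_tmul _ b c

/-- The right action on `A ⊗_p A`, `(b ⊗ c) · a = b ⊗ ca`. -/
def actR (a : A) : ProjTensor A A →L[ℂ] ProjTensor A A :=
  lift (tmulL.flip.comp ((ContinuousLinearMap.mul ℂ A).flip a)).flip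

theorem actR_tmul (a b c : A) : actR a (tmulL b c) = tmulL b (c * a) := lift_tmul _ b c

/-- The product morphism `π_A : A ⊗_p A → A`, `π_A (a ⊗ b) = ab`. -/
def prodMap [CompleteSpace A] : ProjTensor A A →L[ℂ] A :=
  lift (ContinuousLinearMap.mul ℂ A)

theorem prodMap_tmul [CompleteSpace A] (a b : A) : prodMap (tmulL a b) = a * b :=
  lift_tmul _ a b

end ProjTensor

variable (A) [CompleteSpace A]

/-- `A` is approximately biprojective: there is a net `(ρ_i)` of continuous `A`-bimodule morphisms
`A → A ⊗_p A` with `π_A (ρ_i a) → a` for every `a ∈ A`. -/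
def IsApproxBiprojective : Prop :=
  ∃ (ι : Type u) (_ : Preorder ι) (_ : IsDirectedOrder ι) (_ : Nonempty ι)
    (ρ : ι → A →L[ℂ] ProjTensor A A),
    (∀ i a b, ρ i (a * b) = ProjTensor.actL a (ρ i b) ∧
      ρ i (a * b) = ProjTensor.actR b (ρ i a)) ∧
    ∀ a, Tendsto (fun i => ProjTensor.prodMap (ρ i a)) atTop (𝓝 a)

/-- `A` is pseudo-amenable: there is a (not necessarily bounded) net `(m_i)` in `A ⊗_p A` with
`a · m_i - m_i · a → 0` and `π_A (m_i) a → a` for every `a ∈ A`. -/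
def IsPseudoAmenable : Prop :=
  ∃ (ι : Type u) (_ : Preorder ι) (_ : IsDirectedOrder ι) (_ : Nonempty ι)
    (m : ι → ProjTensor A A),
    ∀ a, Tendsto (fun i => ProjTensor.actL a (m i) - ProjTensor.actR a (m i)) atTop (𝓝 0) ∧
      Tendsto (fun i => ProjTensor.prodMap (m i) * a) atTop (𝓝 a)

end BanachAlgebra

/-! ### Amenability -/

/-- `S` is left amenable: there is `m ∈ ℓ¹(S)**` with `δ_s · m = m` for all `s ∈ S` and
`‖m‖ = m(φ) = 1`, where `φ` is the augmentation character. -/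
def IsLeftAmenable (S : Type u) [Semigroup S] : Prop :=
  ∃ m : Bidual (L1 S), (∀ s : S, Bidual.incl (L1 S) (L1.delta s) * m = m) ∧
    ‖m‖ = 1 ∧ m (L1.augmentation S) = 1

/-- `S` is right amenable: there is `m ∈ ℓ¹(S)**` with `m · δ_s = m` for all `s ∈ S` and
`‖m‖ = m(φ) = 1`, where `φ` is the augmentation character. -/
def IsRightAmenable (S : Type u) [Semigroup S] : Prop :=
  ∃ m : Bidual (L1 S), (∀ s : S, m * Bidual.incl (L1 S) (L1.delta s) = m) ∧
    ‖m‖ = 1 ∧ m (L1.augmentation S) = 1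

/-- `S` is amenable: it is left and right amenable. -/
def IsAmenableSemigroup (S : Type u) [Semigroup S] : Prop :=
  IsLeftAmenable S ∧ IsRightAmenable S

end

/-! Put `A = ℓ¹(S)`, let `(ρ_i)` witness approximate biprojectivity of `A**`, and let `p ∈ A` be
central. Then `p` commutes with all of `A**`, so `M_i = ρ_i(p)` satisfies `a · M_i = ρ_i(ap) =
ρ_i(pa) = M_i · a` for `a ∈ A`, while `π(M_i) → p`. Both conclusions come from these elements.

Pseudo-amenability: a functional on `A ⊗_p A` extends to `A** ⊗_p A**` compatibly with the actions
of `A` and with the product map (`extendFunctional`). A linear relation between the functionals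
`ψ_a(a · m - m · a)` and `χ(π(m))` can thus be evaluated at `M_i`, and in the limit it forces `χ(p)
= 0`. Hahn-Banach then yields almost diagonals in `A ⊗_p A` with product near `p`
(`exists_almost_diagonal`). It remains to find central `p` that almost fix finitely many elements.
Take `1 - p = ∏ (1 - δ_e)` over finitely many idempotents. On `δ_s` with local identity `f`, only
the distinct products `e f ≤ f` count, so uniform local finiteness bounds `1 - p` by `2 ^ C`
regardless of the number of factors (`norm_complementOp_delta_le`).

Amenability of `G_e`: the character `groupChar e` sends `δ_s` to `1` or `0` according to whether `s
e ∈ G_e`. Slicing `M_i` for `p = δ_e` by it gives one-sided eigenvectors in `A**`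
(`exists_eigenvector`), which `groupProj e` pushes to translation-invariant functionals of nonzero
mass on `ℓ¹(G_e)*`. These need not be positive. Hahn-Banach replaces them by almost invariant `v ∈
ℓ¹(G_e)`, the functions `|v| / ‖v‖` are almost invariant too, and a weak* limit is an invariant mean
(`exists_invariant_mean`). -/

noncomputable section

/-! ### A consequence of the Hahn-Banach theorem -/

section Separation

/-- A point annihilated by every functional that vanishes on the range of a linear map lies in the
closure of this range. -/
theorem mem_closure_range_of_forall_dual {V W : Type*} [NormedAddCommGroup V] [NormedSpace ℂ V]
    [NormedAddCommGroup W] [NormedSpace ℂ W] (L : V →L[ℂ] W) (w : W)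
    (h : ∀ ψ : StrongDual ℂ W, ψ.comp L = 0 → ψ w = 0) : w ∈ closure (Set.range L) := by
  by_contra hw
  have hconv : Convex ℝ (Set.range L) := by
    rintro _ ⟨x, rfl⟩ _ ⟨y, rfl⟩ a b _ _ _
    refine ⟨(a : ℂ) • x + (b : ℂ) • y, ?_⟩
    rw [map_add, map_smul, map_smul]
    rfl
  obtain ⟨f, r, hf, hr⟩ :=
    RCLike.geometric_hahn_banach_closed_point (𝕜 := ℂ) hconv.closure isClosed_closure hw
  -- A functional whose real part is bounded above on a subspace vanishes there: otherwise some
  -- multiple of `v` would attain exactly the separating value `r`.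
  have hL : ∀ v, f (L v) = 0 := by
    intro v
    by_contra hz
    have := hf (L (((r : ℂ) / f (L v)) • v)) (subset_closure ⟨_, rfl⟩)
    rw [map_smul, map_smul, smul_eq_mul, div_mul_cancel₀ _ hz] at this
    simp at this
  have h0 := h f (ContinuousLinearMap.ext hL)
  have h1 := hf (L 0) (subset_closure ⟨_, rfl⟩)
  rw [hL] at h1
  rw [h0] at hr
  exact lt_asymm h1 hr

/-- If every linear relation `∑ ψ i ∘ D i + χ ∘ T = 0` between functionals forces `χ y = 0`, then
there are vectors `v` with `T v` close to `y` and all the `D i v` close to `0`. -/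
theorem exists_norm_lt_of_forall_dual {V X Y ι : Type*} [Fintype ι] [NormedAddCommGroup V]
    [NormedSpace ℂ V] [NormedAddCommGroup X] [NormedSpace ℂ X] [NormedAddCommGroup Y]
    [NormedSpace ℂ Y] (D : ι → V →L[ℂ] X) (T : V →L[ℂ] Y) (y : Y)
    (h : ∀ (ψ : ι → StrongDual ℂ X) (χ : StrongDual ℂ Y),
      ∑ i, (ψ i).comp (D i) + χ.comp T = 0 → χ y = 0) {ε : ℝ} (hε : 0 < ε) :
    ∃ v, (∀ i, ‖D i v‖ < ε) ∧ ‖T v - y‖ < ε := by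
  classical
  -- All conditions are treated at once by the single map `v ↦ ((D i v)_i, T v)`; the coordinates of
  -- an annihilating functional give the `ψ i` and `χ`.
  have hmem : ((0 : ι → X), y) ∈ closure (Set.range ((ContinuousLinearMap.pi D).prod T)) := by
    refine mem_closure_range_of_forall_dual _ _ fun ψ hψ => ?_
    have := h (fun i => (ψ.comp (ContinuousLinearMap.inl ℂ (ι → X) Y)).comp
      (ContinuousLinearMap.single ℂ (fun _ : ι => X) i))
      (ψ.comp (ContinuousLinearMap.inr ℂ (ι → X) Y)) ?_
    · simpa using this
    · ext v
      have hv : ψ (fun i => D i v, T v) = 0 := DFunLike.congr_fun hψ v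
      have hsum : ∑ i, Pi.single i (D i v) = fun i => D i v :=
        Finset.univ_sum_single fun i => D i v
      simp only [add_apply, sum_apply, ContinuousLinearMap.comp_apply,
        ContinuousLinearMap.inl_apply, ContinuousLinearMap.inr_apply,
        ContinuousLinearMap.single_apply, zero_apply]
      rw [← hv, ← map_sum, ← map_add]
      congr 1
      refine Prod.ext ?_ ?_
      · simp [Prod.fst_sum, hsum]
      · simp [Prod.snd_sum]
  obtain ⟨_, ⟨v, rfl⟩, hv⟩ := Metric.mem_closure_iff.1 hmem ε hε
  rw [dist_comm, dist_eq_norm] at hv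
  have h1 := (Prod.norm_def (((ContinuousLinearMap.pi D).prod T) v - ((0 : ι → X), y))).symm.trans_lt
    hv
  rw [max_lt_iff] at h1
  refine ⟨v, fun i => ?_, h1.2⟩
  refine lt_of_le_of_lt ?_ h1.1
  simpa using norm_le_pi_norm (fun j => D j v) i

end Separation

/-! ### Idempotents of Clifford semigroups -/

namespace IsCliffordSemigroup

variable {S : Type u} [Semigroup S]

/-- If `x` is the inverse of `e f`, then so is `f x e`, whence `x = f x e`, and this makes `x`
idempotent. Now `x` and `e f` are both inverses of `x`, so they coincide. -/
theorem isIdempotentElem_mul (hS : IsCliffordSemigroup S) {e f : S} (he : IsIdempotentElem e)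
    (hf : IsIdempotentElem f) : IsIdempotentElem (e * f) := by
  obtain ⟨x, ⟨hx1, hx2⟩, hx⟩ := hS.1 (e * f)
  have he' : ∀ z, e * (e * z) = e * z := fun z => by rw [← mul_assoc, he.eq]
  have hf' : ∀ z, f * (f * z) = f * z := fun z => by rw [← mul_assoc, hf.eq]
  simp only [mul_assoc] at hx1 hx2
  have hx2' : ∀ z, x * (e * (f * (x * z))) = x * z := fun z => by
    conv_rhs => rw [← hx2]
    simp only [mul_assoc]
  have h1 : f * (x * e) = x := by
    refine hx _ ⟨?_, ?_⟩
    · simp only [mul_assoc, he', hf', hx1]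
    · simp only [mul_assoc, he', hf', hx2']
  have h2 : x * x = x := by
    conv_lhs => rw [← h1]
    simp only [mul_assoc, hx2']
    exact h1
  have h3 : e * f = x := (hS.1 x).unique (y₁ := e * f) (y₂ := x)
    ⟨by simp only [mul_assoc, hx2], by simp only [mul_assoc, hx1]⟩ ⟨by rw [h2, h2], by rw [h2, h2]⟩
  rw [h3]
  exact h2

/-- Since `e f` and `f e` are idempotent, each is an inverse of `e f`; uniqueness of inverses
applies. -/
theorem idempotents_commute (hS : IsCliffordSemigroup S) {e f : S} (he : IsIdempotentElem e)
    (hf : IsIdempotentElem f) : e * f = f * e := by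
  have he' : ∀ z, e * (e * z) = e * z := fun z => by rw [← mul_assoc, he.eq]
  have hf' : ∀ z, f * (f * z) = f * z := fun z => by rw [← mul_assoc, hf.eq]
  have h1 := (hS.isIdempotentElem_mul he hf).eq
  have h2 := (hS.isIdempotentElem_mul hf he).eq
  refine (hS.1 (e * f)).unique ⟨by rw [h1, h1], by rw [h1, h1]⟩ ⟨?_, ?_⟩
  · simp only [mul_assoc, he', hf'] at h1 ⊢
    exact h1
  · simp only [mul_assoc, he', hf'] at h2 ⊢
    exact h2

/-- Idempotents of a Clifford semigroup are central. -/
theorem idempotent_comm (hS : IsCliffordSemigroup S) {e : S} (he : IsIdempotentElem e) (s : S) :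
    e * s = s * e := by
  obtain ⟨t, ⟨ht1, ht2⟩, -⟩ := hS.1 s
  have hst : s * t = t * s := hS.2 s t ⟨ht1, ht2⟩
  have hf : IsIdempotentElem (s * t) := by
    rw [IsIdempotentElem, ← mul_assoc, ht1]
  have hc : e * (s * t) = s * t * e := hS.idempotents_commute he hf
  have he' : ∀ z, e * (e * z) = e * z := fun z => by rw [← mul_assoc, he.eq]
  -- The Clifford condition for this pair becomes `e (s t) = t e s`, the relation that moves `e`
  -- past `s` in the final computation.
  have hinv : IsSemigroupInverse (e * s) (t * e) := by
    constructor
    · calc e * s * (t * e) * (e * s) = e * (s * t * e) * (e * s) := by simp only [mul_assoc]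
        _ = e * (s * t) * (e * s) := by rw [← hc, he']
        _ = s * t * e * (e * s) := by rw [hc]
        _ = s * t * e * s := by simp only [mul_assoc, he']
        _ = e * s := by rw [← hc, mul_assoc, ht1]
    · calc t * e * (e * s) * (t * e) = t * (e * e) * (s * t * e) := by simp only [mul_assoc]
        _ = t * (e * e) * (e * (s * t)) := by rw [hc]
        _ = t * (e * (s * t)) := by rw [he.eq, mul_assoc, he']
        _ = t * s * t * e := by rw [hc]; simp only [mul_assoc]
        _ = t * e := by rw [ht2]
  have h := hS.2 _ _ hinv
  have h1 : e * (s * t) = t * e * s := by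
    calc e * (s * t) = e * (e * (s * t)) := (he' _).symm
      _ = e * s * (t * e) := by rw [hc]; simp only [mul_assoc]
      _ = t * e * (e * s) := h
      _ = t * e * s := by simp only [mul_assoc, he']
  calc e * s = e * (s * t) * s := by rw [mul_assoc, ht1]
    _ = s * t * e * s := by rw [hc]
    _ = s * (t * e * s) := by simp only [mul_assoc]
    _ = s * (s * t * e) := by rw [← h1, hc]
    _ = s * e := by rw [← mul_assoc, hst, ← mul_assoc, ht1]

/-- Every element has a local identity: an idempotent `f = s s* = s* s` with `f s = s`. -/
theorem exists_inverse (hS : IsCliffordSemigroup S) (s : S) :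
    ∃ t, IsSemigroupInverse s t ∧ s * t = t * s ∧ IsIdempotentElem (s * t) := by
  obtain ⟨t, ht, -⟩ := hS.1 s
  exact ⟨t, ht, hS.2 s t ht, by rw [IsIdempotentElem, ← mul_assoc, ht.1]⟩

end IsCliffordSemigroup

/-! ### Commutants in the bidual, and descent of diagonals from the bidual -/

namespace ProjTensor

section Space

variable {E F : Type u} [NormedAddCommGroup E] [NormedSpace ℂ E] [NormedAddCommGroup F]
  [NormedSpace ℂ F]

/-- Continuous linear maps on `E ⊗_p F` are determined by elementary tensors. -/
theorem ext_tmulL {G : Type*} [NormedAddCommGroup G] [NormedSpace ℂ G]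
    {f g : ProjTensor E F →L[ℂ] G} (h : ∀ a b, f (tmulL a b) = g (tmulL a b)) : f = g := by
  ext x
  refine UniformSpace.Completion.induction_on x (isClosed_eq f.continuous g.continuous) fun y => ?_
  have key : (f : ProjTensor E F →ₗ[ℂ] G).comp
      (UniformSpace.Completion.toComplL : AlgTensor E F →L[ℂ] ProjTensor E F).toLinearMap =
      (g : ProjTensor E F →ₗ[ℂ] G).comp
      (UniformSpace.Completion.toComplL : AlgTensor E F →L[ℂ] ProjTensor E F).toLinearMap :=
    TensorProduct.ext' (R := ℂ) (M := E) (N := F) fun a b => h a b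
  exact LinearMap.congr_fun key y

end Space

end ProjTensor

/-! ### Extension of functionals from `A ⊗_p A` to `A** ⊗_p A**` -/

namespace Bidual

section Space

variable {A : Type u} [NormedAddCommGroup A] [NormedSpace ℂ A]

theorem incl_apply (a : A) (φ : StrongDual ℂ A) : incl A a φ = φ a := rfl

/-- Evaluation at a functional `φ ∈ A*`. -/
def evalAt (φ : StrongDual ℂ A) : Bidual A →L[ℂ] ℂ :=
  NormedSpace.inclusionInDoubleDual ℂ (StrongDual ℂ A) φ

theorem evalAt_apply (φ : StrongDual ℂ A) (F : Bidual A) : evalAt φ F = F φ := rfl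

end Space

variable {A : Type u} [NonUnitalNormedRing A] [NormedSpace ℂ A] [IsScalarTower ℂ A A]
  [SMulCommClass ℂ A A]

/-- Multiplying by an element of `A`, here on the left and below on the right, is the second adjoint
of the same multiplication on `A`. Identities in `A` therefore pass to `A**` without any Arens
regularity. -/
theorem incl_mul_apply (a : A) (F : Bidual A) (φ : StrongDual ℂ A) :
    (incl A a * F) φ = F (φ.comp (ContinuousLinearMap.mul ℂ A a)) := rfl

theorem mul_incl_apply (a : A) (F : Bidual A) (φ : StrongDual ℂ A) :
    (F * incl A a) φ = F (φ.comp ((ContinuousLinearMap.mul ℂ A).flip a)) := rfl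

/-- A central element of `A` is central in `A**`. -/
theorem incl_mul_comm {p : A} (hp : ∀ a, p * a = a * p) (F : Bidual A) :
    incl A p * F = F * incl A p := by
  refine ext fun φ => ?_
  rw [incl_mul_apply, mul_incl_apply]
  congr 2
  ext a
  exact hp a

/-- The extension `(F, G) ↦ F (a ↦ G (b ↦ β (a, b)))` of a bounded bilinear form to the biduals. -/
def extendForm (β : A →L[ℂ] A →L[ℂ] ℂ) : Bidual A →L[ℂ] Bidual A →L[ℂ] ℂ :=
  (ContinuousLinearMap.compL ℂ (StrongDual ℂ (StrongDual ℂ A)) (StrongDual ℂ A) ℂ).flip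
    ((ContinuousLinearMap.compL ℂ A (StrongDual ℂ A) ℂ).flip β)

/-- The functional on `A** ⊗_p A**` defined by a functional `Φ` on `A ⊗_p A`. -/
def extendFunctional (Φ : StrongDual ℂ (ProjTensor A A)) :
    StrongDual ℂ (ProjTensor (Bidual A) (Bidual A)) :=
  ProjTensor.lift (E := Bidual A) (F := Bidual A)
    (extendForm ((ContinuousLinearMap.compL ℂ A (ProjTensor A A) ℂ Φ).comp ProjTensor.tmulL))

/-- The functional `a ↦ G (b ↦ Φ (a ⊗ b))`. -/
def slice (Φ : StrongDual ℂ (ProjTensor A A)) (G : Bidual A) : StrongDual ℂ A :=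
  ContinuousLinearMap.comp (G : StrongDual ℂ (StrongDual ℂ A))
    ((ContinuousLinearMap.compL ℂ A (ProjTensor A A) ℂ Φ).comp ProjTensor.tmulL)

omit [IsScalarTower ℂ A A] [SMulCommClass ℂ A A] in
theorem slice_apply (Φ : StrongDual ℂ (ProjTensor A A)) (G : Bidual A) (a : A) :
    slice Φ G a = G (Φ.comp (ProjTensor.tmulL a)) := rfl

theorem extendFunctional_tmul (Φ : StrongDual ℂ (ProjTensor A A)) (F G : Bidual A) :
    extendFunctional Φ (ProjTensor.tmulL F G) = F (slice Φ G) :=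
  ProjTensor.lift_tmul (E := Bidual A) (F := Bidual A) _ F G

theorem extendFunctional_add (Φ Ψ : StrongDual ℂ (ProjTensor A A)) :
    extendFunctional (Φ + Ψ) = extendFunctional Φ + extendFunctional Ψ := by
  refine ProjTensor.ext_tmulL fun F G => ?_
  rw [add_apply, extendFunctional_tmul, extendFunctional_tmul, extendFunctional_tmul,
    ← map_add']
  congr 1
  ext a
  rw [add_apply, slice_apply, slice_apply, slice_apply, ← map_add']
  rfl

theorem extendFunctional_zero :
    extendFunctional (0 : StrongDual ℂ (ProjTensor A A)) = 0 := by
  simpa using extendFunctional_add (0 : StrongDual ℂ (ProjTensor A A)) 0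

theorem extendFunctional_sum {ι : Type*} (s : Finset ι) (Φ : ι → StrongDual ℂ (ProjTensor A A)) :
    extendFunctional (∑ i ∈ s, Φ i) = ∑ i ∈ s, extendFunctional (Φ i) :=
  map_sum (AddMonoidHom.mk' extendFunctional extendFunctional_add) Φ s

theorem extendFunctional_sub (Φ Ψ : StrongDual ℂ (ProjTensor A A)) :
    extendFunctional (Φ - Ψ) = extendFunctional Φ - extendFunctional Ψ :=
  map_sub (AddMonoidHom.mk' extendFunctional extendFunctional_add) Φ Ψ

/-- The left action only touches the outer variable: slicing `Φ ∘ actL a` by `G` gives `slice Φ G`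
precomposed with multiplication by `a`. -/
theorem extendFunctional_comp_actL (Φ : StrongDual ℂ (ProjTensor A A)) (a : A) :
    extendFunctional (Φ.comp (ProjTensor.actL a)) =
      (extendFunctional Φ).comp (ProjTensor.actL (incl A a)) := by
  refine ProjTensor.ext_tmulL fun F G => ?_
  rw [ContinuousLinearMap.comp_apply, ProjTensor.actL_tmul, extendFunctional_tmul,
    extendFunctional_tmul, incl_mul_apply]
  congr 1
  ext b
  rw [slice_apply, ContinuousLinearMap.comp_apply, slice_apply]
  congr 1
  ext c
  exact congrArg Φ (ProjTensor.actL_tmul a b c)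

/-- The right action is absorbed by the inner variable: slicing `Φ ∘ actR a` by `G` is slicing `Φ`
by `G * incl A a`. -/
theorem extendFunctional_comp_actR (Φ : StrongDual ℂ (ProjTensor A A)) (a : A) :
    extendFunctional (Φ.comp (ProjTensor.actR a)) =
      (extendFunctional Φ).comp (ProjTensor.actR (incl A a)) := by
  refine ProjTensor.ext_tmulL fun F G => ?_
  rw [ContinuousLinearMap.comp_apply, ProjTensor.actR_tmul, extendFunctional_tmul,
    extendFunctional_tmul]
  congr 1
  ext b
  rw [slice_apply, slice_apply, mul_incl_apply]
  congr 1
  ext c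
  exact congrArg Φ (ProjTensor.actR_tmul a b c)

/-- The extension applies `G` to the second variable first and `F` to the result, the same order as
in the first Arens product; so `(a, b) ↦ φ (a b)` extends to `(F, G) ↦ (F □ G)(φ)`. -/
theorem extendFunctional_comp_prodMap [CompleteSpace A] (φ : StrongDual ℂ A)
    (M : ProjTensor (Bidual A) (Bidual A)) :
    extendFunctional (φ.comp ProjTensor.prodMap) M = ProjTensor.prodMap M φ := by
  have : extendFunctional (φ.comp ProjTensor.prodMap) =
      (evalAt φ).comp ProjTensor.prodMap := by
    refine ProjTensor.ext_tmulL fun F G => ?_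
    rw [ContinuousLinearMap.comp_apply, ProjTensor.prodMap_tmul, extendFunctional_tmul, evalAt_apply,
      mul_apply]
    congr 1
    ext a
    rw [slice_apply, bidualSMul_apply]
    congr 1
    ext b
    exact congrArg φ (ProjTensor.prodMap_tmul a b)
  exact DFunLike.congr_fun this M

end Bidual

namespace ProjTensor

variable {A : Type u} [NonUnitalNormedRing A] [NormedSpace ℂ A] [IsScalarTower ℂ A A]
  [SMulCommClass ℂ A A] [CompleteSpace A]

/-- If `A**` is approximately biprojective and `p ∈ A` is central, then there are elements of
`A ⊗_p A` that almost commute with finitely many given elements and whose product is close to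
`p`. -/
theorem exists_almost_diagonal (h : IsApproxBiprojective (Bidual A)) {p : A}
    (hp : ∀ a, p * a = a * p) (K : Finset A) {ε : ℝ} (hε : 0 < ε) :
    ∃ m : ProjTensor A A, (∀ a ∈ K, ‖actL a m - actR a m‖ < ε) ∧ ‖prodMap m - p‖ < ε := by
  obtain ⟨ι, _, _, _, ρ, hρ, hlim⟩ := h
  -- By Hahn-Banach it suffices to treat linear relations between functionals. These extend to the
  -- biduals, where exactly commuting elements are available.
  suffices hrel : ∀ (ψ : K → StrongDual ℂ (ProjTensor A A)) (χ : StrongDual ℂ A),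
      ∑ a, (ψ a).comp (actL (a : A) - actR (a : A)) + χ.comp prodMap = 0 → χ p = 0 by
    obtain ⟨m, hm, hm'⟩ := exists_norm_lt_of_forall_dual
      (fun a : K => actL (a : A) - actR (a : A)) (prodMap (A := A)) p hrel hε
    exact ⟨m, fun a ha => hm ⟨a, ha⟩, hm'⟩
  intro ψ χ hψχ
  have hcomm : ∀ i (a : A), actL (Bidual.incl A a) (ρ i (Bidual.incl A p)) =
      actR (Bidual.incl A a) (ρ i (Bidual.incl A p)) := by
    intro i a
    rw [← (hρ i _ _).1, ← Bidual.incl_mul_comm hp, (hρ i _ _).2]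
  have hzero : ∀ i, prodMap (ρ i (Bidual.incl A p)) χ = 0 := by
    intro i
    -- Evaluated at `ρ i (incl A p)`, the extended relation loses all commutator terms by `hcomm`,
    -- and only the product term is left.
    have h1 := congrArg (fun Φ => Bidual.extendFunctional Φ (ρ i (Bidual.incl A p))) hψχ
    simp only [Bidual.extendFunctional_add, Bidual.extendFunctional_sum,
      Bidual.extendFunctional_zero, ContinuousLinearMap.comp_sub, Bidual.extendFunctional_sub,
      Bidual.extendFunctional_comp_actL, Bidual.extendFunctional_comp_actR, add_apply, sum_apply,
      sub_apply, ContinuousLinearMap.comp_apply, hcomm, sub_self, Finset.sum_const_zero, zero_add,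
      zero_apply, Bidual.extendFunctional_comp_prodMap] at h1
    exact h1
  have hlim' := ((Bidual.evalAt χ).continuous.tendsto _).comp (hlim (Bidual.incl A p))
  refine tendsto_nhds_unique hlim' ?_
  refine tendsto_const_nhds.congr fun i => ?_
  exact (hzero i).symm

end ProjTensor

/-! ### Pseudo-amenability from almost diagonals -/

section PseudoAmenable

variable {A : Type u} [NonUnitalNormedRing A] [NormedSpace ℂ A] [IsScalarTower ℂ A A]
  [SMulCommClass ℂ A A] [CompleteSpace A]

/-- A Banach algebra is pseudo-amenable if it has approximate diagonals on finite sets. -/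
theorem isPseudoAmenable_of_forall_finset
    (h : ∀ (K : Finset A) (ε : ℝ), 0 < ε → ∃ m : ProjTensor A A, ∀ a ∈ K,
      ‖ProjTensor.actL a m - ProjTensor.actR a m‖ < ε ∧ ‖ProjTensor.prodMap m * a - a‖ < ε) :
    IsPseudoAmenable A := by
  classical
  -- The net is indexed by pairs of a finite set and a precision `n`, with tolerance `1 / (n + 1)`.
  choose m hm using fun i : Finset A × ℕ => h i.1 (1 / ((i.2 : ℝ) + 1)) Nat.one_div_pos_of_nat
  have key : ∀ (a : A) (ε : ℝ), 0 < ε → ∀ᶠ i in (atTop : Filter (Finset A × ℕ)),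
      ‖ProjTensor.actL a (m i) - ProjTensor.actR a (m i)‖ < ε ∧
        ‖ProjTensor.prodMap (m i) * a - a‖ < ε := by
    intro a ε hε
    obtain ⟨n, hn⟩ := exists_nat_one_div_lt hε
    filter_upwards [eventually_ge_atTop (({a} : Finset A), n)] with i hi
    have hle := (Nat.one_div_le_one_div (α := ℝ) hi.2).trans_lt hn
    have := hm i a (hi.1 (Finset.mem_singleton_self a))
    exact ⟨this.1.trans hle, this.2.trans hle⟩
  refine ⟨Finset A × ℕ, inferInstance, inferInstance, inferInstance, m, fun a => ⟨?_, ?_⟩⟩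
  · refine Metric.tendsto_nhds.2 fun ε hε => (key a ε hε).mono fun i hi => ?_
    rw [dist_zero_right]
    exact hi.1
  · refine Metric.tendsto_nhds.2 fun ε hε => (key a ε hε).mono fun i hi => ?_
    rw [dist_eq_norm]
    exact hi.2

/-- If `A` has central approximate identities and `A**` is approximately biprojective, then `A` is
pseudo-amenable. -/
theorem isPseudoAmenable_of_isApproxBiprojective_bidual
    (h : IsApproxBiprojective (Bidual A))
    (hA : ∀ (K : Finset A) (ε : ℝ), 0 < ε → ∃ p : A, (∀ a, p * a = a * p) ∧
      ∀ a ∈ K, ‖p * a - a‖ < ε) : IsPseudoAmenable A := by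
  refine isPseudoAmenable_of_forall_finset fun K ε hε => ?_
  obtain ⟨p, hp, hpK⟩ := hA K (ε / 2) (half_pos hε)
  obtain ⟨R, hR0, hR⟩ : ∃ R : ℝ, 0 < R ∧ ∀ a ∈ K, ‖a‖ ≤ R :=
    ⟨(∑ a ∈ K, ‖a‖) + 1, by positivity, fun a ha =>
      (Finset.single_le_sum (f := fun a => ‖a‖) (fun _ _ => norm_nonneg _) ha).trans
        (le_add_of_nonneg_right zero_le_one)⟩
  -- The tolerance `(ε / 2) / R` survives multiplication by elements of `K`, whose norms are at most
  -- `R`; the other `ε / 2` pays for replacing `p * a` by `a`.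
  obtain ⟨m, hm, hm'⟩ := ProjTensor.exists_almost_diagonal h hp K
    (lt_min hε (div_pos (half_pos hε) hR0))
  refine ⟨m, fun a ha => ⟨(hm a ha).trans_le (min_le_left _ _), ?_⟩⟩
  have h1 : ProjTensor.prodMap m * a - a = (ProjTensor.prodMap m - p) * a + (p * a - a) := by
    rw [sub_mul]
    abel
  have h2 : ‖(ProjTensor.prodMap m - p) * a‖ ≤ ε / 2 := by
    refine (norm_mul_le _ _).trans ?_
    refine (mul_le_mul (hm'.le.trans (min_le_right _ _)) (hR a ha) (norm_nonneg _)
      (by positivity)).trans_eq ?_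
    exact div_mul_cancel₀ _ hR0.ne'
  rw [h1]
  exact (norm_add_le _ _).trans_lt (by linarith [hpK a ha])

end PseudoAmenable

/-! ### Central approximate identities in `ℓ¹(S)` -/

namespace L1

section Space

variable {S : Type u}

theorem hasSum_smul_delta (f : L1 S) : HasSum (fun s => f s • delta s) f := by
  classical
  have h := lp.hasSum_single (E := fun _ : S => ℂ) (p := 1) (by simp) f
  have hs : ∀ s, lp.single (E := fun _ : S => ℂ) 1 s (f s) = f s • delta s := fun s => by
    rw [delta, ← lp.single_smul, smul_eq_mul, mul_one]
  simpa only [hs] using h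

theorem norm_delta (s : S) : ‖delta s‖ = 1 := by
  classical
  simp [delta, lp.norm_single]

/-- A bounded operator on `ℓ¹(S)` is bounded by its values at point masses. -/
theorem norm_apply_le {E : Type*} [NormedAddCommGroup E] [NormedSpace ℂ E] (T : L1 S →L[ℂ] E)
    {M : ℝ} (hT : ∀ s, ‖T (delta s)‖ ≤ M) (f : L1 S) : ‖T f‖ ≤ M * ‖f‖ := by
  have h1 : HasSum (fun s => T (f s • delta s)) (T f) := (hasSum_smul_delta f).mapL T
  have hle : ∀ s, ‖T (f s • delta s)‖ ≤ M * ‖f s‖ := fun s => by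
    rw [map_smul, norm_smul, mul_comm]
    exact mul_le_mul_of_nonneg_right (hT s) (norm_nonneg _)
  rw [← h1.tsum_eq, norm_eq, ← tsum_mul_left]
  exact tsum_of_norm_bounded ((summable_norm f).mul_left M).hasSum hle

end Space

variable {S : Type u} [Semigroup S]

theorem delta_mul_delta (s t : S) : delta s * delta t = delta (s * t) := conv_delta s t

theorem delta_comm {e : S} (he : ∀ s, e * s = s * e) (a : L1 S) :
    delta e * a = a * delta e := by
  have : ContinuousLinearMap.mul ℂ (L1 S) (delta e) =
      (ContinuousLinearMap.mul ℂ (L1 S)).flip (delta e) := by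
    refine ext_delta fun s => ?_
    rw [ContinuousLinearMap.mul_apply', ContinuousLinearMap.flip_apply,
      ContinuousLinearMap.mul_apply', delta_mul_delta, delta_mul_delta, he]
  exact DFunLike.congr_fun this a

/-- The operator `a ↦ (1 - δ_{e₁}) ⋯ (1 - δ_{eₙ}) a`. -/
def complementOp : List S → L1 S → L1 S
  | [], a => a
  | e :: l, a => complementOp l a - delta e * complementOp l a

/-- Although `1` need not lie in `ℓ¹(S)`, the element `p = 1 - ∏ (1 - δ_e)` does: expanding one more
factor replaces `p` by `δ_e + p - δ_e p`, which stays central. -/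
theorem exists_complementOp_eq (l : List S) (hl : ∀ e ∈ l, ∀ s, e * s = s * e) :
    ∃ p : L1 S, (∀ a, p * a = a * p) ∧ ∀ a, complementOp l a = a - p * a := by
  induction l with
  | nil => exact ⟨0, by simp, by simp [complementOp]⟩
  | cons e l ih =>
    obtain ⟨p, hp, hpl⟩ := ih fun x hx => hl x (List.mem_cons_of_mem _ hx)
    have he := delta_comm (hl e List.mem_cons_self)
    refine ⟨delta e + p - delta e * p, fun a => ?_, fun a => ?_⟩
    · have h1 : delta e * p * a = a * (delta e * p) := by
        rw [mul_assoc, hp, ← mul_assoc, he, mul_assoc]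
      rw [sub_mul, add_mul, mul_sub, mul_add, he, hp, h1]
    · rw [complementOp, hpl, mul_sub, sub_mul, add_mul, mul_assoc]
      abel

/-- The factor `1 - δ_e` annihilates `δ_s`, and by centrality its position in the product is
irrelevant. -/
theorem complementOp_delta_of_mem (l : List S) (hl : ∀ e ∈ l, ∀ s, e * s = s * e) {e s : S}
    (he : e ∈ l) (hes : e * s = s) : complementOp l (delta s) = 0 := by
  induction l with
  | nil => simp at he
  | cons x l ih =>
    have hl' : ∀ e ∈ l, ∀ s, e * s = s * e := fun x hx => hl x (List.mem_cons_of_mem _ hx)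
    rcases List.mem_cons.1 he with rfl | he
    · obtain ⟨p, hp, hpl⟩ := exists_complementOp_eq l hl'
      rw [complementOp, hpl, mul_sub, delta_mul_delta, hes, hp, ← mul_assoc, delta_mul_delta, hes,
        sub_self]
    · rw [complementOp, ih hl' he, mul_zero, sub_zero]

theorem norm_complementOp_le (l : List S) (a : L1 S) :
    ‖complementOp l a‖ ≤ 2 ^ l.length * ‖a‖ := by
  induction l with
  | nil => simp [complementOp]
  | cons e l ih =>
    have h1 := norm_sub_le (complementOp l a) (delta e * complementOp l a)
    have h2 := norm_mul_le (delta e) (complementOp l a)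
    rw [norm_delta, one_mul] at h2
    rw [complementOp, List.length_cons, pow_succ]
    linarith

/-- On the point mass at `s`, the factors `1 - δ_e` may be replaced by distinct factors
`1 - δ_{e f}`, where `f` is a local identity of `s`. -/
theorem exists_nodup_complementOp (hS : IsCliffordSemigroup S) (l : List S)
    (hl : ∀ e ∈ l, IsIdempotentElem e) {f s : S} (hf : IsIdempotentElem f) (hfs : f * s = s) :
    ∃ l' : List S, l'.Nodup ∧ (∀ e ∈ l', e ∈ idempotentsBelow f) ∧
      complementOp l (delta s) = complementOp l' (delta s) := by
  induction l with
  | nil => exact ⟨[], by simp, by simp, rfl⟩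
  | cons e l ih =>
    obtain ⟨l', hn, hb, heq⟩ := ih fun x hx => hl x (List.mem_cons_of_mem _ hx)
    have he : IsIdempotentElem e := hl e List.mem_cons_self
    have hc : ∀ x ∈ l', ∀ s, x * s = s * x := fun x hx => hS.idempotent_comm (hb x hx).1
    obtain ⟨p, hp, hpl⟩ := exists_complementOp_eq l' hc
    have hef : IsIdempotentElem (e * f) := hS.isIdempotentElem_mul he hf
    have hmul : ∀ x : S, delta x * complementOp l' (delta s) = complementOp l' (delta (x * s)) := by
      intro x
      rw [hpl, hpl, mul_sub, delta_mul_delta, ← mul_assoc, ← hp, mul_assoc, delta_mul_delta]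
    -- Since `f s = s`, the idempotents `e` and `e f` act alike on `s`.
    have hstep : complementOp (e :: l) (delta s) = complementOp (e * f :: l') (delta s) := by
      rw [complementOp, complementOp, heq, hmul, hmul, mul_assoc, hfs]
    -- A repeated factor is redundant: `δ_{ef}` times the product is the product at `δ_{efs}`, which
    -- the factor already present kills.
    by_cases hmem : e * f ∈ l'
    · refine ⟨l', hn, hb, ?_⟩
      rw [hstep, complementOp, hmul,
        complementOp_delta_of_mem l' hc hmem (s := e * f * s) (by rw [← mul_assoc, hef.eq]), sub_zero]
    · refine ⟨e * f :: l', List.nodup_cons.2 ⟨hmem, hn⟩, ?_, hstep⟩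
      intro x hx
      rcases List.mem_cons.1 hx with rfl | hx
      · refine ⟨hef, by rw [mul_assoc, hf.eq], ?_⟩
        rw [hS.idempotents_commute he hf, ← mul_assoc, hf.eq]
      · exact hb x hx

/-- The bound does not depend on `l`: after reduction the factors are distinct idempotents below the
local identity of `s`, so at most `C` remain, each of norm at most `2`. -/
theorem norm_complementOp_delta_le (hS : IsCliffordSemigroup S) {C : ℕ}
    (hC : ∀ e : S, IsIdempotentElem e →
      (idempotentsBelow e).Finite ∧ (idempotentsBelow e).ncard ≤ C)
    (l : List S) (hl : ∀ e ∈ l, IsIdempotentElem e) (s : S) :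
    ‖complementOp l (delta s)‖ ≤ 2 ^ C := by
  classical
  obtain ⟨t, ht, -, hf⟩ := hS.exists_inverse s
  obtain ⟨l', hn, hb, heq⟩ := exists_nodup_complementOp hS l hl hf ht.1
  have hlen : l'.length ≤ C := by
    rw [← List.toFinset_card_of_nodup hn, ← Set.ncard_coe_finset]
    refine (Set.ncard_le_ncard ?_ (hC _ hf).1).trans (hC _ hf).2
    intro x hx
    exact hb x (by simpa using hx)
  rw [heq]
  refine (norm_complementOp_le l' _).trans ?_
  rw [norm_delta, mul_one]
  exact pow_le_pow_right₀ one_le_two hlen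

/-- If `E(S)` is uniformly locally finite, then `ℓ¹(S)` has central approximate identities. -/
theorem exists_central_approx_identity (hS : IsCliffordSemigroup S)
    (hE : IdempotentsUniformlyLocallyFinite S) (K : Finset (L1 S)) {ε : ℝ} (hε : 0 < ε) :
    ∃ p : L1 S, (∀ a, p * a = a * p) ∧ ∀ a ∈ K, ‖p * a - a‖ < ε := by
  obtain ⟨C, hC⟩ := hE
  -- The truncation error is taken below `ε / 2 ^ C` because `1 - p` will kill the truncations and
  -- have norm at most `2 ^ C`.
  have hev : ∀ᶠ T in (atTop : Filter (Finset S)), ∀ a ∈ K,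
      ‖∑ s ∈ T, a s • delta s - a‖ < ε / 2 ^ C := by
    rw [Filter.eventually_all_finset]
    intro a _
    have := Metric.tendsto_nhds.1 (hasSum_smul_delta a) (ε / 2 ^ C) (by positivity)
    simpa only [dist_eq_norm, SummationFilter.unconditional_filter] using this
  obtain ⟨T, hT⟩ := hev.exists
  choose t ht _ hf using hS.exists_inverse
  -- The factors are the local identities of the points of `T`, so that `p` fixes `δ_s` for every `s
  -- ∈ T`.
  have hl : ∀ e ∈ T.toList.map fun s => s * t s, IsIdempotentElem e := by
    intro e he
    obtain ⟨s, -, rfl⟩ := List.mem_map.1 he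
    exact hf s
  have hl' : ∀ e ∈ T.toList.map fun s => s * t s, ∀ s, e * s = s * e :=
    fun e he => hS.idempotent_comm (hl e he)
  obtain ⟨p, hp, hpl⟩ := exists_complementOp_eq _ hl'
  refine ⟨p, hp, fun a ha => ?_⟩
  let Q : L1 S →L[ℂ] L1 S := ContinuousLinearMap.id ℂ _ - ContinuousLinearMap.mul ℂ _ p
  have hQ : ∀ b, Q b = b - p * b := fun b => rfl
  have hzero : Q (∑ s ∈ T, a s • delta s) = 0 := by
    rw [map_sum]
    refine Finset.sum_eq_zero fun s hs => ?_
    rw [map_smul, hQ, ← hpl, complementOp_delta_of_mem _ hl'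
      (List.mem_map.2 ⟨s, Finset.mem_toList.2 hs, rfl⟩) (ht s).1, smul_zero]
  have hnorm := norm_apply_le Q (M := 2 ^ C)
    (fun s => by rw [hQ, ← hpl]; exact norm_complementOp_delta_le hS hC _ hl s)
    (∑ s ∈ T, a s • delta s - a)
  rw [map_sub, hzero, zero_sub, norm_neg, hQ, norm_sub_rev] at hnorm
  refine hnorm.trans_lt ?_
  rw [← lt_div_iff₀' (by positivity)]
  exact hT a ha

end L1

/-! ### Functionals in the bidual that are invariant up to a character -/

namespace Bidual

/-- An element of the bidual as an additive map. -/
def toAddMonoidHom {A : Type u} [NormedAddCommGroup A] [NormedSpace ℂ A] (F : Bidual A) :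
    StrongDual ℂ A →+ ℂ := AddMonoidHom.mk' F (map_add' F)

variable {A : Type u} [NonUnitalNormedRing A] [NormedSpace ℂ A] [IsScalarTower ℂ A A]
  [SMulCommClass ℂ A A]

/-- A character of `A` induces a character of `A**`. -/
theorem mul_apply_character {φ : StrongDual ℂ A} (hφ : ∀ a b, φ (a * b) = φ a * φ b)
    (F G : Bidual A) : (F * G) φ = F φ * G φ := by
  have : bidualSMul G φ = G φ • φ := by
    ext a
    have h1 : dualSMul φ a = φ a • φ := by
      ext b
      exact hφ a b
    rw [bidualSMul_apply, h1, map_smul', smul_apply, smul_eq_mul, mul_comm]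
  rw [mul_apply, this, map_smul', mul_comm]

theorem smul_apply (c : ℂ) (F : Bidual A) (φ : StrongDual ℂ A) : (c • F) φ = c * F φ := rfl

/-- The map `F ⊗ G ↦ G(φ) F`. -/
def sliceLeft (φ : StrongDual ℂ A) : ProjTensor (Bidual A) (Bidual A) →L[ℂ] Bidual A :=
  ProjTensor.lift (ContinuousLinearMap.smulRightL ℂ (Bidual A) (Bidual A) (evalAt φ))

/-- The map `F ⊗ G ↦ F(φ) G`. -/
def sliceRight (φ : StrongDual ℂ A) : ProjTensor (Bidual A) (Bidual A) →L[ℂ] Bidual A :=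
  ProjTensor.lift (ContinuousLinearMap.smulRightL ℂ (Bidual A) (Bidual A) (evalAt φ)).flip

theorem sliceLeft_tmul (φ : StrongDual ℂ A) (F G : Bidual A) :
    sliceLeft φ (ProjTensor.tmulL F G) = G φ • F :=
  ProjTensor.lift_tmul _ F G

theorem sliceRight_tmul (φ : StrongDual ℂ A) (F G : Bidual A) :
    sliceRight φ (ProjTensor.tmulL F G) = F φ • G :=
  ProjTensor.lift_tmul _ F G

theorem sliceLeft_actL (φ : StrongDual ℂ A) (F : Bidual A)
    (M : ProjTensor (Bidual A) (Bidual A)) :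
    sliceLeft φ (ProjTensor.actL F M) = F * sliceLeft φ M := by
  have : (sliceLeft φ).comp (ProjTensor.actL F) =
      (ContinuousLinearMap.mul ℂ (Bidual A) F).comp (sliceLeft φ) := by
    refine ProjTensor.ext_tmulL fun G H => ?_
    rw [ContinuousLinearMap.comp_apply, ContinuousLinearMap.comp_apply, ProjTensor.actL_tmul,
      sliceLeft_tmul, sliceLeft_tmul, map_smul, ContinuousLinearMap.mul_apply']
  exact DFunLike.congr_fun this M

theorem sliceRight_actR (φ : StrongDual ℂ A) (F : Bidual A)
    (M : ProjTensor (Bidual A) (Bidual A)) :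
    sliceRight φ (ProjTensor.actR F M) = sliceRight φ M * F := by
  have : (sliceRight φ).comp (ProjTensor.actR F) =
      ((ContinuousLinearMap.mul ℂ (Bidual A)).flip F).comp (sliceRight φ) := by
    refine ProjTensor.ext_tmulL fun G H => ?_
    rw [ContinuousLinearMap.comp_apply, ContinuousLinearMap.comp_apply, ProjTensor.actR_tmul,
      sliceRight_tmul, sliceRight_tmul, map_smul, ContinuousLinearMap.flip_apply,
      ContinuousLinearMap.mul_apply']
  exact DFunLike.congr_fun this M

variable {φ : StrongDual ℂ A} (hφ : ∀ a b, φ (a * b) = φ a * φ b)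
include hφ

/-- The action hits the leg evaluated at `φ`; as `φ` is multiplicative on `A**`, it becomes a
scalar. -/
theorem sliceLeft_actR (F : Bidual A) (M : ProjTensor (Bidual A) (Bidual A)) :
    sliceLeft φ (ProjTensor.actR F M) = F φ • sliceLeft φ M := by
  have : (sliceLeft φ).comp (ProjTensor.actR F) = F φ • sliceLeft φ := by
    refine ProjTensor.ext_tmulL fun G H => ?_
    rw [ContinuousLinearMap.comp_apply, ProjTensor.actR_tmul, sliceLeft_tmul,
      mul_apply_character hφ, _root_.smul_apply, sliceLeft_tmul, smul_smul, mul_comm]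
  exact DFunLike.congr_fun this M

theorem sliceRight_actL (F : Bidual A) (M : ProjTensor (Bidual A) (Bidual A)) :
    sliceRight φ (ProjTensor.actL F M) = F φ • sliceRight φ M := by
  have : (sliceRight φ).comp (ProjTensor.actL F) = F φ • sliceRight φ := by
    refine ProjTensor.ext_tmulL fun G H => ?_
    rw [ContinuousLinearMap.comp_apply, ProjTensor.actL_tmul, sliceRight_tmul,
      mul_apply_character hφ, _root_.smul_apply, sliceRight_tmul, smul_smul]
  exact DFunLike.congr_fun this M

theorem sliceLeft_apply_character (M : ProjTensor (Bidual A) (Bidual A)) :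
    sliceLeft φ M φ = ProjTensor.prodMap M φ := by
  have : (evalAt φ).comp (sliceLeft φ) = (evalAt φ).comp ProjTensor.prodMap := by
    refine ProjTensor.ext_tmulL fun F G => ?_
    rw [ContinuousLinearMap.comp_apply, ContinuousLinearMap.comp_apply, sliceLeft_tmul,
      ProjTensor.prodMap_tmul, evalAt_apply, evalAt_apply, mul_apply_character hφ, smul_apply,
      mul_comm]
  exact DFunLike.congr_fun this M

theorem sliceRight_apply_character (M : ProjTensor (Bidual A) (Bidual A)) :
    sliceRight φ M φ = ProjTensor.prodMap M φ := by
  have : (evalAt φ).comp (sliceRight φ) = (evalAt φ).comp ProjTensor.prodMap := by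
    refine ProjTensor.ext_tmulL fun F G => ?_
    rw [ContinuousLinearMap.comp_apply, ContinuousLinearMap.comp_apply, sliceRight_tmul,
      ProjTensor.prodMap_tmul, evalAt_apply, evalAt_apply, mul_apply_character hφ, smul_apply]
  exact DFunLike.congr_fun this M

/-- If `A**` is approximately biprojective, then it contains left and right eigenvectors for each
character of `A` that does not vanish on the centre. -/
theorem exists_eigenvector (h : IsApproxBiprojective (Bidual A)) {p : A}
    (hp : ∀ a, p * a = a * p) (hpφ : φ p ≠ 0) :
    (∃ N : Bidual A, (∀ a, incl A a * N = φ a • N) ∧ N φ ≠ 0) ∧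
      ∃ N : Bidual A, (∀ a, N * incl A a = φ a • N) ∧ N φ ≠ 0 := by
  obtain ⟨ι, _, _, _, ρ, hρ, hlim⟩ := h
  have hcomm : ∀ i (a : A), ProjTensor.actL (incl A a) (ρ i (incl A p)) =
      ProjTensor.actR (incl A a) (ρ i (incl A p)) := by
    intro i a
    rw [← (hρ i _ _).1, ← incl_mul_comm hp, (hρ i _ _).2]
  have hlim' : Tendsto (fun i => ProjTensor.prodMap (ρ i (incl A p)) φ) atTop (𝓝 (φ p)) :=
    ((evalAt φ).continuous.tendsto _).comp (hlim (incl A p))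
  -- One index is enough: the commutation is exact at every index, and convergence only serves to
  -- make the value at `φ` nonzero.
  obtain ⟨i, hi⟩ := (hlim'.eventually_ne hpφ).exists
  refine ⟨⟨sliceLeft φ (ρ i (incl A p)), fun a => ?_, ?_⟩,
    ⟨sliceRight φ (ρ i (incl A p)), fun a => ?_, ?_⟩⟩
  · rw [← sliceLeft_actL, hcomm, sliceLeft_actR hφ, incl_apply]
  · rwa [sliceLeft_apply_character hφ]
  · rw [← sliceRight_actR, ← hcomm, sliceRight_actL hφ, incl_apply]
  · rwa [sliceRight_apply_character hφ]

end Bidual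

/-! ### Invariant means from invariant functionals -/

namespace L1

section Mean

variable {G : Type u}

theorem augmentation_apply (f : L1 G) : augmentation G f = ∑' s, f s := rfl

theorem augmentation_delta (s : G) : augmentation G (delta s) = 1 := by
  classical
  rw [augmentation_apply, tsum_eq_single s]
  · simp [delta, lp.single_apply]
  · intro t ht
    simp [delta, lp.single_apply, Pi.single_eq_of_ne ht]

theorem norm_augmentation_apply_le (f : L1 G) : ‖augmentation G f‖ ≤ ‖f‖ := by
  rw [norm_eq]
  exact norm_tsum_le_tsum_norm (summable_norm f)

/-- The pointwise absolute value. -/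
def absVal (f : L1 G) : L1 G :=
  ⟨fun s => (‖f s‖ : ℂ), memℓp_gen (by simpa using summable_norm f)⟩

theorem absVal_apply (f : L1 G) (s : G) : absVal f s = (‖f s‖ : ℂ) := rfl

theorem norm_absVal (f : L1 G) : ‖absVal f‖ = ‖f‖ := by
  simp [norm_eq, absVal_apply]

theorem augmentation_absVal (f : L1 G) : augmentation G (absVal f) = (‖f‖ : ℂ) := by
  rw [augmentation_apply, norm_eq, Complex.ofReal_tsum]
  rfl

/-- As `T` permutes coefficients, it commutes with the pointwise absolute value; the reverse
triangle inequality then applies coordinatewise. -/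
theorem norm_map_absVal_sub_le {T : L1 G →L[ℂ] L1 G} {τ : G ≃ G}
    (hT : ∀ f y, T f (τ y) = f y) (f : L1 G) :
    ‖T (absVal f) - absVal f‖ ≤ ‖T f - f‖ := by
  rw [norm_eq, norm_eq]
  refine Summable.tsum_le_tsum (fun s => ?_) (summable_norm _) (summable_norm _)
  obtain ⟨y, rfl⟩ := τ.surjective s
  rw [lp.coeFn_sub, lp.coeFn_sub, Pi.sub_apply, Pi.sub_apply, hT, hT, absVal_apply, absVal_apply,
    ← Complex.ofReal_sub, Complex.norm_real]
  exact abs_norm_sub_norm_le _ _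

/-- An invariant functional with nonzero total mass yields almost invariant probability
measures. -/
theorem exists_almost_invariant {κ : Type*} (T : κ → L1 G →L[ℂ] L1 G) (τ : κ → G ≃ G)
    (hT : ∀ k f y, T k f (τ k y) = f y) (n : Bidual (L1 G))
    (hn : ∀ k (ψ : StrongDual ℂ (L1 G)), n (ψ.comp (T k)) = n ψ) (hn1 : n (augmentation G) ≠ 0)
    (K : Finset κ) {ε : ℝ} (hε : 0 < ε) :
    ∃ f : L1 G, ‖f‖ = 1 ∧ augmentation G f = 1 ∧ ∀ k ∈ K, ‖T k f - f‖ < ε := by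
  suffices hrel : ∀ (ψ : K → StrongDual ℂ (L1 G)) (χ : StrongDual ℂ ℂ),
      ∑ k, (ψ k).comp (T k - ContinuousLinearMap.id ℂ _) + χ.comp (augmentation G) = 0 →
        χ 1 = 0 by
    obtain ⟨v, hv, hv1⟩ := exists_norm_lt_of_forall_dual
      (fun k : K => T k - ContinuousLinearMap.id ℂ _) (augmentation G) (1 : ℂ) hrel
      (lt_min (half_pos hε) one_half_pos)
    have hlow : 1 / 2 ≤ ‖v‖ := by
      have h1 := norm_sub_norm_le (1 : ℂ) (augmentation G v)
      rw [norm_one, norm_sub_rev] at h1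
      have h2 := hv1.le.trans (min_le_right _ _)
      linarith [norm_augmentation_apply_le v]
    have hpos : 0 < ‖v‖ := by linarith
    have hne : (‖v‖ : ℂ) ≠ 0 := by exact_mod_cast hpos.ne'
    -- Total mass within `1 / 2` of `1` forces `‖v‖ ≥ 1 / 2`, so normalising at most doubles the
    -- error `ε / 2`.
    refine ⟨((‖v‖ : ℂ)⁻¹) • absVal v, ?_, ?_, fun k hk => ?_⟩
    · rw [norm_smul, norm_absVal, norm_inv, Complex.norm_real, norm_norm,
        inv_mul_cancel₀ hpos.ne']
    · rw [map_smul, augmentation_absVal, smul_eq_mul, inv_mul_cancel₀ hne]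
    · rw [map_smul, ← smul_sub, norm_smul, norm_inv, Complex.norm_real, norm_norm,
        inv_mul_lt_iff₀ hpos]
      have h1 := (norm_map_absVal_sub_le (hT k) v).trans_lt
        ((hv ⟨k, hk⟩).trans_le (min_le_left _ _))
      nlinarith
  intro ψ χ hψχ
  -- Applying `n` to the relation removes the invariance terms and leaves `χ 1 * n (augmentation G)
  -- = 0`.
  have h1 : ∀ k : K, n ((ψ k).comp (T k - ContinuousLinearMap.id ℂ _)) = 0 := by
    intro k
    rw [ContinuousLinearMap.comp_sub, ContinuousLinearMap.comp_id]
    exact ((ContinuousLinearMap.map_sub (n : StrongDual ℂ (StrongDual ℂ (L1 G))) _ _)).trans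
      (sub_eq_zero.2 (hn k (ψ k)))
  have h2 : χ.comp (augmentation G) = χ 1 • augmentation G := by
    ext f
    rw [ContinuousLinearMap.comp_apply, smul_apply, smul_eq_mul]
    conv_lhs => rw [← mul_one (augmentation G f), ← smul_eq_mul, map_smul, smul_eq_mul, mul_comm]
  have h4 : n (∑ k, (ψ k).comp (T k - ContinuousLinearMap.id ℂ _)) = 0 :=
    (map_sum (Bidual.toAddMonoidHom n) _ _).trans
      (Finset.sum_eq_zero fun k _ => h1 k)
  have h5 := congrArg n hψχ
  rw [Bidual.map_add', h4, zero_add, h2, Bidual.map_smul'] at h5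
  have h6 : n 0 = 0 := ContinuousLinearMap.map_zero (n : StrongDual ℂ (StrongDual ℂ (L1 G)))
  rw [h6] at h5
  exact (mul_eq_zero.1 h5).resolve_right hn1

/-- An invariant functional with nonzero total mass yields an invariant mean. -/
theorem exists_invariant_mean {κ : Type*} (T : κ → L1 G →L[ℂ] L1 G) (τ : κ → G ≃ G)
    (hT : ∀ k f y, T k f (τ k y) = f y) (n : Bidual (L1 G))
    (hn : ∀ k (ψ : StrongDual ℂ (L1 G)), n (ψ.comp (T k)) = n ψ)
    (hn1 : n (augmentation G) ≠ 0) :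
    ∃ m : Bidual (L1 G), (∀ k (ψ : StrongDual ℂ (L1 G)), m (ψ.comp (T k)) = m ψ) ∧ ‖m‖ = 1 ∧
      m (augmentation G) = 1 := by
  classical
  choose f hf1 hf2 hf3 using fun i : Finset κ × ℕ =>
    exists_almost_invariant T τ hT n hn hn1 i.1 (ε := 1 / ((i.2 : ℝ) + 1)) Nat.one_div_pos_of_nat
  let U : Ultrafilter (Finset κ × ℕ) := Ultrafilter.of atTop
  have hU : (U : Filter (Finset κ × ℕ)) ≤ atTop := Ultrafilter.of_le _
  let F : Finset κ × ℕ → WeakDual ℂ (StrongDual ℂ (L1 G)) := fun i =>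
    StrongDual.toWeakDual (NormedSpace.inclusionInDoubleDual ℂ (L1 G) (f i))
  -- Banach-Alaoglu: the almost invariant probability densities lie in the unit ball of the bidual,
  -- so they converge weak* along the ultrafilter.
  obtain ⟨m, hm, hmU⟩ := (WeakDual.isCompact_closedBall (𝕜 := ℂ)
    (0 : StrongDual ℂ (StrongDual ℂ (L1 G))) 1).ultrafilter_le_nhds (U.map F) (by
      rw [Ultrafilter.coe_map, le_principal_iff, mem_map]
      refine univ_mem' fun i => ?_
      simp only [Set.mem_preimage, mem_closedBall_zero_iff]
      exact (NormedSpace.double_dual_bound ℂ (L1 G) (f i)).trans_eq (hf1 i))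
  have hlim : ∀ ψ : StrongDual ℂ (L1 G), Tendsto (fun i => ψ (f i)) U (𝓝 (m ψ)) := fun ψ =>
    ((WeakDual.eval_continuous ψ).tendsto m).comp hmU
  have haug : m (augmentation G) = 1 := by
    refine tendsto_nhds_unique (hlim _) ?_
    simp only [hf2]
    exact tendsto_const_nhds
  let m' : Bidual (L1 G) := WeakDual.toStrongDual m
  have hm' : ∀ ψ, m' ψ = m ψ := fun _ => rfl
  have hle : ‖m'‖ ≤ 1 := mem_closedBall_zero_iff.1 hm
  refine ⟨m', fun k ψ => ?_, le_antisymm hle ?_, haug⟩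
  · have h1 := (hlim (ψ.comp (T k))).sub (hlim ψ)
    have h2 : Tendsto (fun i => (ψ.comp (T k)) (f i) - ψ (f i)) U (𝓝 0) := by
      refine Tendsto.mono_left ?_ hU
      have h3 : Tendsto (fun i => T k (f i) - f i) atTop (𝓝 0) := by
        refine Metric.tendsto_nhds.2 fun ε hε => ?_
        obtain ⟨N, hN⟩ := exists_nat_one_div_lt hε
        filter_upwards [eventually_ge_atTop (({k} : Finset κ), N)] with i hi
        rw [dist_zero_right]
        exact (hf3 i k (hi.1 (Finset.mem_singleton_self k))).trans
          ((Nat.one_div_le_one_div (α := ℝ) hi.2).trans_lt hN)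
      have h4 := (ψ.continuous.tendsto 0).comp h3
      rw [map_zero] at h4
      refine h4.congr fun i => ?_
      exact map_sub ψ _ _
    exact sub_eq_zero.1 (tendsto_nhds_unique h1 h2)
  · have h1 := Bidual.le_norm m' (augmentation G)
    rw [hm', haug, norm_one] at h1
    have h2 : ‖augmentation G‖ ≤ 1 := ContinuousLinearMap.opNorm_le_bound _ zero_le_one fun g => by
      rw [one_mul]
      exact norm_augmentation_apply_le g
    nlinarith [norm_nonneg m']

end Mean

end L1

/-! ### Maximal subgroups of Clifford semigroups -/

section MaximalSubgroup

variable {S : Type u} [Semigroup S] {e : S}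

theorem maximalSubgroup.id_mul {g : S} (hg : g ∈ maximalSubgroup e) : e * g = g := by
  obtain ⟨t, ht, h1, -⟩ := hg
  rw [← h1, ht.1]

theorem maximalSubgroup.mul_id {g : S} (hg : g ∈ maximalSubgroup e) : g * e = g := by
  obtain ⟨t, ht, -, h2⟩ := hg
  rw [← h2, ← mul_assoc, ht.1]

theorem maximalSubgroup.exists_inverse {g : S} (hg : g ∈ maximalSubgroup e) :
    ∃ t ∈ maximalSubgroup e, g * t = e ∧ t * g = e := by
  obtain ⟨t, ht, h1, h2⟩ := hg
  exact ⟨t, ⟨g, ⟨ht.2, ht.1⟩, h2, h1⟩, h1, h2⟩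

theorem maximalSubgroup.bijective_mul_left (g : maximalSubgroup e) :
    Function.Bijective fun x : maximalSubgroup e => g * x := by
  obtain ⟨t, ht, h1, h2⟩ := maximalSubgroup.exists_inverse g.2
  refine ⟨fun x y hxy => ?_, fun y => ⟨⟨t, ht⟩ * y, ?_⟩⟩
  · have h : (g : S) * x = g * y := congrArg Subtype.val hxy
    have := congrArg (t * ·) h
    simp only [← mul_assoc, h2] at this
    rw [maximalSubgroup.id_mul x.2, maximalSubgroup.id_mul y.2] at this
    exact Subtype.ext this
  · refine Subtype.ext ?_
    change (g : S) * (t * y) = y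
    rw [← mul_assoc, h1, maximalSubgroup.id_mul y.2]

theorem maximalSubgroup.bijective_mul_right (g : maximalSubgroup e) :
    Function.Bijective fun x : maximalSubgroup e => x * g := by
  obtain ⟨t, ht, h1, h2⟩ := maximalSubgroup.exists_inverse g.2
  refine ⟨fun x y hxy => ?_, fun y => ⟨y * ⟨t, ht⟩, ?_⟩⟩
  · have h : (x : S) * g = y * g := congrArg Subtype.val hxy
    have := congrArg (· * t) h
    simp only [mul_assoc, h1] at this
    rw [maximalSubgroup.mul_id x.2, maximalSubgroup.mul_id y.2] at this
    exact Subtype.ext this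
  · refine Subtype.ext ?_
    change (y : S) * t * g = y
    rw [mul_assoc, h2, maximalSubgroup.mul_id y.2]

namespace IsCliffordSemigroup

variable (hS : IsCliffordSemigroup S) (he : IsIdempotentElem e)
include hS he

/-- With `t` the inverse of `x`, `x t e = x t x z = e`, while centrality of `e` and `e x = x` give
`x t e = x t`. Hence the local identity of `x` is `e`. -/
theorem mem_maximalSubgroup_of_mul_eq {x z : S} (hx : e * x = x) (hz : x * z = e) :
    x ∈ maximalSubgroup e := by
  obtain ⟨t, ht, hc, hf⟩ := hS.exists_inverse x
  have h1 : x * t * e = e := by rw [← hz, ← mul_assoc, ht.1]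
  have h2 : x * t = e := by
    rw [← h1, ← hS.idempotent_comm he, ← mul_assoc, hx]
  exact ⟨t, ht, h2, hc ▸ h2⟩

theorem mem_maximalSubgroup_of_mul_eq' {x z : S} (hx : e * x = x) (hz : z * x = e) :
    x ∈ maximalSubgroup e := by
  obtain ⟨t, ht, hc, hf⟩ := hS.exists_inverse x
  have h1 : e * (t * x) = e := by rw [← hz, mul_assoc, ← mul_assoc x, ht.1]
  have h2 : t * x = e := by
    rw [← h1, hS.idempotent_comm he, mul_assoc, ← hS.idempotent_comm he, hx]
  exact ⟨t, ht, hc.trans h2, h2⟩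

theorem mul_mul_idempotent (s t : S) : s * t * e = s * e * (t * e) := by
  rw [mul_assoc s e, hS.idempotent_comm he (t * e), mul_assoc t, he.eq, mul_assoc]

/-- `S e` is a monoid with identity `e` and unit group `G_e`, in which one-sided invertible elements
are units; so a product is a unit only if both factors are. This makes `groupChar e` multiplicative.
-/
theorem mul_idempotent_mem_iff (s t : S) :
    s * t * e ∈ maximalSubgroup e ↔ s * e ∈ maximalSubgroup e ∧ t * e ∈ maximalSubgroup e := by
  have hid : ∀ x, e * (x * e) = x * e := fun x => by
    rw [hS.idempotent_comm he, mul_assoc, he.eq]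
  rw [hS.mul_mul_idempotent he]
  refine ⟨fun h => ?_, fun h => mul_mem h.1 h.2⟩
  obtain ⟨z, -, h1, h2⟩ := maximalSubgroup.exists_inverse h
  rw [mul_assoc] at h1
  rw [← mul_assoc] at h2
  exact ⟨hS.mem_maximalSubgroup_of_mul_eq he (hid s) h1,
    hS.mem_maximalSubgroup_of_mul_eq' he (hid t) h2⟩

end IsCliffordSemigroup

end MaximalSubgroup

/-! ### The projection of `ℓ¹(S)` onto `ℓ¹(G_e)` -/

namespace L1

section Extend

variable {S : Type u} {E : Type*} [NormedAddCommGroup E] [NormedSpace ℂ E] [CompleteSpace E]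

theorem summable_smul {v : S → E} (hv : ∀ s, ‖v s‖ ≤ 1) (f : L1 S) :
    Summable fun s => f s • v s :=
  Summable.of_norm_bounded (summable_norm f) fun s => by
    rw [norm_smul]
    exact mul_le_of_le_one_right (norm_nonneg _) (hv s)

/-- The bounded operator on `ℓ¹(S)` with prescribed values in the unit ball at point masses. -/
def ofUnitBall (v : S → E) (hv : ∀ s, ‖v s‖ ≤ 1) : L1 S →L[ℂ] E :=
  LinearMap.mkContinuous
    { toFun := fun f => ∑' s, f s • v s
      map_add' := fun f g => by
        rw [← (summable_smul hv f).tsum_add (summable_smul hv g)]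
        simp only [lp.coeFn_add, Pi.add_apply, add_smul]
      map_smul' := fun c f => by
        rw [RingHom.id_apply, ← (summable_smul hv f).tsum_const_smul c]
        simp only [lp.coeFn_smul, Pi.smul_apply, smul_assoc] } 1
    (fun f => by
      rw [one_mul, norm_eq]
      refine tsum_of_norm_bounded (summable_norm f).hasSum fun s => ?_
      rw [norm_smul]
      exact mul_le_of_le_one_right (norm_nonneg _) (hv s))

theorem ofUnitBall_delta (v : S → E) (hv : ∀ s, ‖v s‖ ≤ 1) (s : S) :
    ofUnitBall v hv (delta s) = v s := by
  classical
  change ∑' t, (delta s : L1 S) t • v t = v s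
  rw [tsum_eq_single s]
  · simp [delta, lp.single_apply]
  · intro t ht
    simp [delta, lp.single_apply, Pi.single_eq_of_ne ht]

end Extend

variable {S : Type u} [Semigroup S]

open Classical in
/-- The point mass at `s e` if `s e ∈ G_e`, and `0` otherwise. -/
def groupPart (e s : S) : L1 (maximalSubgroup e) :=
  if h : s * e ∈ maximalSubgroup e then delta ⟨s * e, h⟩ else 0

theorem norm_groupPart_le (e s : S) : ‖groupPart e s‖ ≤ 1 := by
  rw [groupPart]
  split_ifs
  · rw [norm_delta]
  · simp

/-- The projection of `ℓ¹(S)` onto `ℓ¹(G_e)`. -/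
def groupProj (e : S) : L1 S →L[ℂ] L1 (maximalSubgroup e) :=
  ofUnitBall (groupPart e) (norm_groupPart_le e)

theorem groupProj_delta (e s : S) : groupProj e (delta s) = groupPart e s :=
  ofUnitBall_delta _ _ s

/-- The character `δ_s ↦ 1` if `s e ∈ G_e`, `δ_s ↦ 0` otherwise. -/
def groupChar (e : S) : StrongDual ℂ (L1 S) :=
  (augmentation (maximalSubgroup e)).comp (groupProj e)

open Classical in
theorem groupChar_delta (e s : S) :
    groupChar e (delta s) = if s * e ∈ maximalSubgroup e then 1 else 0 := by
  rw [groupChar, ContinuousLinearMap.comp_apply, groupProj_delta, groupPart]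
  split_ifs
  · rw [augmentation_delta]
  · rw [map_zero]

variable (hS : IsCliffordSemigroup S) {e : S} (he : IsIdempotentElem e)

theorem groupChar_delta_coe (g : maximalSubgroup e) : groupChar e (delta (g : S)) = 1 := by
  rw [groupChar_delta, if_pos]
  rw [maximalSubgroup.mul_id g.2]
  exact g.2

include he in
theorem idempotent_mem_maximalSubgroup : e ∈ maximalSubgroup e :=
  ⟨e, ⟨by rw [he.eq, he.eq], by rw [he.eq, he.eq]⟩, he.eq, he.eq⟩

include hS he

theorem groupChar_mul (a b : L1 S) :
    groupChar e (a * b) = groupChar e a * groupChar e b := by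
  have : (ContinuousLinearMap.compL ℂ (L1 S) (L1 S) ℂ (groupChar e)).comp
      (ContinuousLinearMap.mul ℂ (L1 S)) = (groupChar e).smulRight (groupChar e) := by
    refine ext_delta fun s => ext_delta fun t => ?_
    change groupChar e (delta s * delta t) = groupChar e (delta s) * groupChar e (delta t)
    rw [delta_mul_delta, groupChar_delta, groupChar_delta, groupChar_delta,
      hS.mul_idempotent_mem_iff he]
    split_ifs <;> simp_all
  exact DFunLike.congr_fun (DFunLike.congr_fun this a) b

theorem groupPart_mul_left (g : maximalSubgroup e) (s : S) :
    groupPart e (g * s) = delta g * groupPart e s := by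
  have hge := maximalSubgroup.mul_id g.2
  have h1 := hS.mul_idempotent_mem_iff he g s
  rw [hge] at h1
  rw [groupPart, groupPart]
  by_cases hs : s * e ∈ maximalSubgroup e
  · rw [dif_pos hs, dif_pos (h1.2 ⟨g.2, hs⟩), delta_mul_delta]
    congr 1
    exact Subtype.ext (mul_assoc _ _ _)
  · rw [dif_neg hs, dif_neg fun h => hs (h1.1 h).2, mul_zero]

theorem groupPart_mul_right (g : maximalSubgroup e) (s : S) :
    groupPart e (s * g) = groupPart e s * delta g := by
  have hge := maximalSubgroup.mul_id g.2
  have h1 := hS.mul_idempotent_mem_iff he s g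
  have h2 := hS.mul_mul_idempotent he s g
  rw [hge] at h1 h2
  rw [groupPart, groupPart]
  by_cases hs : s * e ∈ maximalSubgroup e
  · rw [dif_pos hs, dif_pos (h1.2 ⟨hs, g.2⟩), delta_mul_delta]
    congr 1
    exact Subtype.ext h2
  · rw [dif_neg hs, dif_neg fun h => hs (h1.1 h).1, zero_mul]

/-- Equivariance under `G_e` is what turns eigenvectors over `ℓ¹(S)` into invariant functionals over
`ℓ¹(G_e)`. -/
theorem groupProj_mul_left (g : maximalSubgroup e) (a : L1 S) :
    groupProj e (delta (g : S) * a) = delta g * groupProj e a := by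
  have : (groupProj e).comp (ContinuousLinearMap.mul ℂ (L1 S) (delta (g : S))) =
      (ContinuousLinearMap.mul ℂ (L1 (maximalSubgroup e)) (delta g)).comp (groupProj e) := by
    refine ext_delta fun s => ?_
    rw [ContinuousLinearMap.comp_apply, ContinuousLinearMap.comp_apply,
      ContinuousLinearMap.mul_apply', ContinuousLinearMap.mul_apply', delta_mul_delta,
      groupProj_delta, groupProj_delta, groupPart_mul_left hS he]
  exact DFunLike.congr_fun this a

theorem groupProj_mul_right (g : maximalSubgroup e) (a : L1 S) :
    groupProj e (a * delta (g : S)) = groupProj e a * delta g := by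
  have : (groupProj e).comp ((ContinuousLinearMap.mul ℂ (L1 S)).flip (delta (g : S))) =
      ((ContinuousLinearMap.mul ℂ (L1 (maximalSubgroup e))).flip (delta g)).comp
        (groupProj e) := by
    refine ext_delta fun s => ?_
    rw [ContinuousLinearMap.comp_apply, ContinuousLinearMap.comp_apply,
      ContinuousLinearMap.flip_apply, ContinuousLinearMap.flip_apply,
      ContinuousLinearMap.mul_apply', ContinuousLinearMap.mul_apply', delta_mul_delta,
      groupProj_delta, groupProj_delta, groupPart_mul_right hS he]
  exact DFunLike.congr_fun this a

end L1

/-! ### Amenability of semigroups with bijective translations -/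

section Amenable

/-- The bidual of a bounded operator. -/
def Bidual.map {A B : Type u} [NormedAddCommGroup A] [NormedSpace ℂ A] [NormedAddCommGroup B]
    [NormedSpace ℂ B] (θ : A →L[ℂ] B) (F : Bidual A) : Bidual B :=
  ContinuousLinearMap.comp (F : StrongDual ℂ (StrongDual ℂ A))
    ((ContinuousLinearMap.compL ℂ A B ℂ).flip θ)

theorem Bidual.map_apply {A B : Type u} [NormedAddCommGroup A] [NormedSpace ℂ A]
    [NormedAddCommGroup B] [NormedSpace ℂ B] (θ : A →L[ℂ] B) (F : Bidual A)
    (ψ : StrongDual ℂ B) : Bidual.map θ F ψ = F (ψ.comp θ) := rfl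

/-- An operator that maps point masses to point masses along an injective map transports
coefficients along this map. -/
theorem L1.apply_of_map_delta {G : Type u} {T : L1 G →L[ℂ] L1 G} {τ : G → G}
    (hτ : Function.Injective τ) (hT : ∀ s, T (L1.delta s) = L1.delta (τ s)) (f : L1 G) (y : G) :
    T f (τ y) = f y := by
  classical
  have : (lp.evalCLM ℂ (fun _ : G => ℂ) 1 (τ y)).comp T = lp.evalCLM ℂ (fun _ : G => ℂ) 1 y := by
    refine L1.ext_delta fun s => ?_
    rw [ContinuousLinearMap.comp_apply, hT]
    change (L1.delta (τ s) : L1 G) (τ y) = (L1.delta s : L1 G) y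
    simp [L1.delta, lp.single_apply, Pi.single_apply, hτ.eq_iff]
  exact DFunLike.congr_fun this f

variable {G : Type u} [Semigroup G]

/-- Bijective translations permute the coefficients of `ℓ¹(G)`, which is the form required by
`L1.exists_invariant_mean`. -/
theorem isLeftAmenable_of_invariant (hG : ∀ g : G, Function.Bijective fun x => g * x)
    (n : Bidual (L1 G)) (hn : ∀ g, Bidual.incl (L1 G) (L1.delta g) * n = n)
    (hn1 : n (L1.augmentation G) ≠ 0) : IsLeftAmenable G := by
  obtain ⟨m, hm, hm1, hm2⟩ := L1.exists_invariant_mean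
    (fun g : G => ContinuousLinearMap.mul ℂ (L1 G) (L1.delta g))
    (fun g => Equiv.ofBijective _ (hG g))
    (fun g => L1.apply_of_map_delta (hG g).injective fun s => L1.delta_mul_delta g s) n
    (fun g ψ => DFunLike.congr_fun (hn g) ψ) hn1
  exact ⟨m, fun g => Bidual.ext fun ψ => hm g ψ, hm1, hm2⟩

theorem isRightAmenable_of_invariant (hG : ∀ g : G, Function.Bijective fun x => x * g)
    (n : Bidual (L1 G)) (hn : ∀ g, n * Bidual.incl (L1 G) (L1.delta g) = n)
    (hn1 : n (L1.augmentation G) ≠ 0) : IsRightAmenable G := by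
  obtain ⟨m, hm, hm1, hm2⟩ := L1.exists_invariant_mean
    (fun g : G => (ContinuousLinearMap.mul ℂ (L1 G)).flip (L1.delta g))
    (fun g => Equiv.ofBijective _ (hG g))
    (fun g => L1.apply_of_map_delta (hG g).injective fun s => L1.delta_mul_delta s g) n
    (fun g ψ => DFunLike.congr_fun (hn g) ψ) hn1
  exact ⟨m, fun g => Bidual.ext fun ψ => hm g ψ, hm1, hm2⟩

variable {S : Type u} [Semigroup S]

/-- If `ℓ¹(S)**` is approximately biprojective, then the maximal subgroups of the Clifford
semigroup `S` are amenable. -/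
theorem isAmenableSemigroup_maximalSubgroup (hS : IsCliffordSemigroup S)
    (h : IsApproxBiprojective (Bidual (L1 S))) {e : S} (he : IsIdempotentElem e) :
    IsAmenableSemigroup (maximalSubgroup e) := by
  have hchar : L1.groupChar e (L1.delta e) ≠ 0 := by
    rw [L1.groupChar_delta_coe ⟨e, L1.idempotent_mem_maximalSubgroup he⟩]
    exact one_ne_zero
  obtain ⟨⟨N, hN, hN1⟩, N', hN', hN1'⟩ := Bidual.exists_eigenvector (L1.groupChar_mul hS he) h
    (L1.delta_comm (hS.idempotent_comm he)) hchar
  -- The mass of the pushed-forward functional is, by definition, `N (groupChar e)`, so `hN1` and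
  -- `hN1'` apply directly. Invariance holds because `groupChar e` is `1` at the elements of `G_e`.
  refine ⟨isLeftAmenable_of_invariant maximalSubgroup.bijective_mul_left
      (Bidual.map (L1.groupProj e) N) (fun g => Bidual.ext fun ψ => ?_) hN1,
    isRightAmenable_of_invariant maximalSubgroup.bijective_mul_right
      (Bidual.map (L1.groupProj e) N') (fun g => Bidual.ext fun ψ => ?_) hN1'⟩
  · have h1 := DFunLike.congr_fun (hN (L1.delta (g : S))) (ψ.comp (L1.groupProj e))
    rw [L1.groupChar_delta_coe, one_smul, Bidual.incl_mul_apply] at h1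
    rw [Bidual.incl_mul_apply, Bidual.map_apply, Bidual.map_apply, ← h1]
    congr 1
    ext a
    exact congrArg ψ (L1.groupProj_mul_left hS he g a).symm
  · have h1 := DFunLike.congr_fun (hN' (L1.delta (g : S))) (ψ.comp (L1.groupProj e))
    rw [L1.groupChar_delta_coe, one_smul, Bidual.mul_incl_apply] at h1
    rw [Bidual.mul_incl_apply, Bidual.map_apply, Bidual.map_apply, ← h1]
    congr 1
    ext a
    exact congrArg ψ (L1.groupProj_mul_right hS he g a).symm

end Amenable

end

theorem mainTheorem2 (S : Type u) [Semigroup S] (hS : IsCliffordSemigroup S)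
    (hE : IdempotentsUniformlyLocallyFinite S)
    (h : IsApproxBiprojective (Bidual (L1 S))) :
    (∀ e : S, IsIdempotentElem e → IsAmenableSemigroup (maximalSubgroup e)) ∧
      IsPseudoAmenable (L1 S) :=
  ⟨fun _ he => isAmenableSemigroup_maximalSubgroup hS h he,
    isPseudoAmenable_of_isApproxBiprojective_bidual h
      (fun K _ hε => L1.exists_central_approx_identity hS hE K hε)⟩
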